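/- Let $X$ be a finite set and let $p(\cdot|t)$, $t\in K\subseteq\mathbb R$, be probability distributions on $X$. Let $\theta_1,\dots,\theta_n$ be interior points of $K$ such that $p(x|\theta_i)>0$ and $t\mapsto p(x|t)$ is differentiable at $\theta_i$ for all $x,i$, and let $w_i\ge0$, $\sum_i w_i=1$. For $m$ i.i.d. repetitions put $p(\vec x|t)=\prod_{r=1}^m p(x_r|t)$ and $g_j(\vec x)=\partial_\theta p(\vec x|\theta_j)$. For an estimator $\hat\theta_m:X^m\to\mathbb R$ let $$\mathcal C^{(i)}(m)_{jk}=\sum_{\vec x}\frac{g_j(\vec x)g_k(\vec x)}{p(\vec x|\theta_i)},\quad b^{(i)}_j=\sum_{\vec x}g_j(\vec x)\big[\hat\theta_m(\vec x)-\mathbb E_{\theta_i}\hat\theta_m\big],\quad \overline{\rm Var}(\hat\theta_m)=\sum_i w_i{\rm Var}_{\theta_i}(\hat\theta_m),$$ $$\mathcal B^{\rm FG}=\sum_i w_i\,b^{(i)\top}\mathcal C^{(i)}(m)^+b^{(i)},\qquad \mathcal B^{\rm GCR}=\sum_i w_i\frac{(b^{(i)}_i)^2}{\mathcal C^{(i)}(m)_{ii}},$$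 where $^+$ is the Moore–Penrose pseudoinverse and $0/0=0$. Write $b_j=b^{(j)}_j$, $F_i=\sum_x(\partial_\theta p(x|\theta_i))^2/p(x|\theta_i)$, and $u\sim v$ if $u-v=o(v)$ as $m\to\infty$. Then: 1. For every $m$ and every estimator, $\mathcal B^{\rm FG}$ (resp. $\mathcal B^{\rm GCR}$) is the supremum, over all (resp. all diagonal) real $n\times n$ matrices $A$ with columns $a_i$, of $\big(\sum_i w_ia_i^\top b^{(i)}\big)^2\big/\sum_i w_ia_i^\top\mathcal C^{(i)}(m)a_i$ (with $0/0=0$), and $\mathcal B^{\rm GCR}\le\mathcal B^{\rm FG}\le\overline{\rm Var}(\hat\theta_m)$. 2. If $P,Q$ are probability distributions on $X$ with $P(x)>0$ whenever $Q(x)>0$, then $\sum_x Q(x)^2/P(x)\ge1$ (terms with $P(x)=Q(x)=0$ being $0$), with equality if and only if $Q=P$. 3. Let $D_m$ be symmetric $k\times k$ matrices, $v_m\in\operatorname{Range}(D_m)$ and $c_m\in\mathbb R$, with $D_m^+\to0$, $(v_m)$ bounded and $|c_m|\ge\varepsilon$ for some $\varepsilon>0$ and all $m$. Then $\begin{pmatrix}D_m&v_m\\v_m^\top&c_m\end{pmatrix}^+-\begin{pmatrix}0&0\\0&1/c_m\end{pmatrix}\to0$.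 4. With $\Lambda_{jk}=\sum_x\frac{p(x|\theta_j)p(x|\theta_k)}{p(x|\theta_i)}$ and $R_{jk}=\sum_x\frac{p(x|\theta_k)\,\partial_\theta p(x|\theta_j)}{p(x|\theta_i)}$, for all $m,i,j,k$, $$\mathcal C^{(i)}(m)_{jk}=m(m-1)\Lambda_{jk}^{m-2}R_{jk}R_{kj}+m\Lambda_{jk}^{m-1}\mathcal C^{(i)}(1)_{jk},\qquad \mathcal C^{(i)}(1)_{jk}=\sum_x\frac{\partial_\theta p(x|\theta_j)\,\partial_\theta p(x|\theta_k)}{p(x|\theta_i)},$$ a term with factor $m$ or $m-1$ equal to $0$ being read as $0$. 5. If $p(\cdot|\theta_j)\ne p(\cdot|\theta_i)$ for all $j\ne i$, then $\big(\mathcal C^{(i)}(m)/m\big)^+$ converges as $m\to\infty$ to the matrix whose only nonzero entry is $1/\mathcal C^{(i)}(1)_{ii}$ in position $(i,i)$ (to $0$ if $\mathcal C^{(i)}(1)_{ii}=0$). 6. Suppose that, whenever $p(\cdot|\theta_j)=p(\cdot|\theta_i)$, the function $\partial_\theta p(\cdot|\theta_j)$ is a scalar multiple of $\partial_\theta p(\cdot|\theta_i)$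 (this holds in particular if the distributions $p(\cdot|\theta_i)$ are pairwise distinct). Let $(\hat\theta_m)_m$ be any sequence of estimators. If $b_j^2=O(\sum_i w_ib_i^2)$ for each $j$ with $w_j=0$ (no condition if all weights are positive), then $\mathcal B^{\rm FG}\sim\mathcal B^{\rm GCR}$. If all $b_j=O(1)$, then $m(\mathcal B^{\rm FG}-\mathcal B^{\rm GCR})\to0$. 7. Suppose that $K$ is compact, each $p(x|\cdot)$ is continuous on $K$ and $C^1$ near each $\theta_i$, $p(\cdot|t)\neq p(\cdot|\theta_i)$ for all $i$ and all $t\in K\setminus\{\theta_i\}$, and $F_i>0$ for all $i$. Then every sequence of maximum-likelihood estimators over $K$ saturates both bounds: $\overline{\rm Var}(\hat\theta_m)\sim\mathcal B^{\rm GCR}$, $\overline{\rm Var}(\hat\theta_m)\sim\mathcal B^{\rm FG}$, and $m\,\overline{\rm Var}(\hat\theta_m)\to\sum_i w_i/F_i$. 8. If $p(\cdot|\theta_i)\ne p(\cdot|\theta_j)$ whenever $\theta_i\neq\theta_j$, then for every sequence of maximum-likelihood estimators over the finite set $\{\theta_1,\dots,\theta_n\}$, $m(\overline{\rm Var}(\hat\theta_m)-\mathcal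 B^{\rm GCR})\to0$ and $m(\overline{\rm Var}(\hat\theta_m)-\mathcal B^{\rm FG})\to0$. -/

import Mathlib

open Filter Topology Asymptotics Matrix

/-- `B` is a Moore–Penrose pseudoinverse of the real matrix `A` (the four Penrose equations). -/
structure IsMoorePenrose {ι κ : Type*} [Fintype ι] [Fintype κ]
    (A : Matrix ι κ ℝ) (B : Matrix κ ι ℝ) : Prop where
  mul_mul_self : A * B * A = A
  self_mul_mul : B * A * B = B
  symm_left : (A * B)ᵀ = A * B
  symm_right : (B * A)ᵀ = B * A

theorem exists_isMoorePenrose_of_isSymm {ι : Type*} [Fintype ι] [DecidableEq ι]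
    (A : Matrix ι ι ℝ) (hA : Aᵀ = A) :
    ∃ B, IsMoorePenrose A B ∧ Bᵀ = B := by
  have hH : A.IsHermitian := by
    rw [Matrix.IsHermitian, Matrix.conjTranspose_eq_transpose_of_trivial, hA]
  obtain ⟨U, d, hU, hAU⟩ : ∃ (U : Matrix ι ι ℝ) (d : ι → ℝ), Uᵀ * U = 1 ∧
      A = U * Matrix.diagonal d * Uᵀ := by
    refine ⟨hH.eigenvectorUnitary, hH.eigenvalues, ?_, ?_⟩
    · have := Unitary.coe_star_mul_self hH.eigenvectorUnitary
      rwa [Matrix.star_eq_conjTranspose, Matrix.conjTranspose_eq_transpose_of_trivial] at this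
    · have := hH.spectral_theorem
      rw [Unitary.conjStarAlgAut_apply, Matrix.star_eq_conjTranspose,
        Matrix.conjTranspose_eq_transpose_of_trivial] at this
      exact this
  have key : ∀ e f : ι → ℝ, (U * Matrix.diagonal e * Uᵀ) * (U * Matrix.diagonal f * Uᵀ)
      = U * Matrix.diagonal (fun i => e i * f i) * Uᵀ := by
    intro e f
    calc _ = U * Matrix.diagonal e * (Uᵀ * U) * Matrix.diagonal f * Uᵀ := by
          simp only [Matrix.mul_assoc]
      _ = _ := by rw [hU, Matrix.mul_one, Matrix.mul_assoc U, Matrix.diagonal_mul_diagonal]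
  have hsymm : ∀ e : ι → ℝ, (U * Matrix.diagonal e * Uᵀ)ᵀ = U * Matrix.diagonal e * Uᵀ := by
    intro e
    simp [Matrix.transpose_mul, Matrix.mul_assoc]
  refine ⟨U * Matrix.diagonal (fun i => (d i)⁻¹) * Uᵀ, ⟨?_, ?_, ?_, ?_⟩, hsymm _⟩
  · rw [hAU, key, key]
    congr 3
    funext i
    exact mul_inv_mul_cancel (d i)
  · rw [hAU, key, key]
    congr 3
    funext i
    simpa using mul_inv_mul_cancel ((d i)⁻¹)
  · rw [hAU, key, hsymm]
  · rw [hAU, key, hsymm]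

theorem exists_isMoorePenrose {ι κ : Type*} [Fintype ι] [Fintype κ]
    (A : Matrix ι κ ℝ) : ∃ B, IsMoorePenrose A B := by
  classical
  obtain ⟨P, hP, hPs⟩ := exists_isMoorePenrose_of_isSymm (Aᵀ * A) (by simp)
  have h1 : A * (P * (Aᵀ * A)) = A := by
    have h0 : Aᵀ * A * (P * (Aᵀ * A) - 1) = 0 := by
      rw [Matrix.mul_sub, Matrix.mul_one, ← Matrix.mul_assoc, hP.mul_mul_self, sub_self]
    have h2 := (Matrix.conjTranspose_mul_self_mul_eq_zero A (P * (Aᵀ * A) - 1)).1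
      (by simpa [Matrix.conjTranspose_eq_transpose_of_trivial] using h0)
    rw [Matrix.mul_sub, Matrix.mul_one, sub_eq_zero] at h2
    exact h2
  refine ⟨P * Aᵀ, ⟨?_, ?_, ?_, ?_⟩⟩
  · simpa only [Matrix.mul_assoc] using h1
  · have := congrArg (· * Aᵀ) hP.self_mul_mul
    simpa only [Matrix.mul_assoc] using this
  · simp [Matrix.transpose_mul, hPs, Matrix.mul_assoc]
  · have := hP.symm_right
    simpa only [Matrix.mul_assoc] using this

theorem IsMoorePenrose.unique {ι κ : Type*} [Fintype ι] [Fintype κ]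
    {A : Matrix ι κ ℝ} {B C : Matrix κ ι ℝ}
    (hB : IsMoorePenrose A B) (hC : IsMoorePenrose A C) : B = C := by
  have e1 : A * B = A * C := by
    calc A * B = (A * C * A * B) := by rw [hC.mul_mul_self]
      _ = (A * C)ᵀ * (A * B)ᵀ := by rw [hC.symm_left, hB.symm_left, ← Matrix.mul_assoc]
      _ = (A * B * A * C)ᵀ := by rw [← Matrix.transpose_mul, ← Matrix.mul_assoc]
      _ = A * C := by rw [hB.mul_mul_self, hC.symm_left]
  have e2 : B * A = C * A := by
    calc B * A = B * (A * C * A) := by rw [hC.mul_mul_self]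
      _ = (B * A)ᵀ * (C * A)ᵀ := by rw [hC.symm_right, hB.symm_right]; simp only [Matrix.mul_assoc]
      _ = (C * (A * B * A))ᵀ := by
          rw [← Matrix.transpose_mul]; simp only [Matrix.mul_assoc]
      _ = C * A := by rw [hB.mul_mul_self, hC.symm_right]
  calc B = B * A * B := hB.self_mul_mul.symm
    _ = C * A * C := by rw [e2, Matrix.mul_assoc, e1, ← Matrix.mul_assoc]
    _ = C := hC.self_mul_mul

/-- The Moore–Penrose pseudoinverse of a real matrix. -/
noncomputable def pinv {ι κ : Type*} [Fintype ι] [Fintype κ] (A : Matrix ι κ ℝ) :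
    Matrix κ ι ℝ :=
  (exists_isMoorePenrose A).choose

/-! ### Global-score bounds for a finite family of distributions

`P i y` is the probability of the outcome `y` at the `i`-th parameter value, `g j` is the test
function attached to the `j`-th parameter value, `h` is an estimator and `w` are the weights. -/

/-- Expectation of `h` under the probability vector `P`. -/
def mean {Y : Type*} [Fintype Y] (P h : Y → ℝ) : ℝ := ∑ y, P y * h y

/-- Weighted variance `∑ i, w i * Var_i h`. -/
def weightedVar {n : ℕ} {Y : Type*} [Fintype Y] (w : Fin n → ℝ) (P : Fin n → Y → ℝ)
    (h : Y → ℝ) : ℝ :=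
  ∑ i, w i * ∑ y, P i y * (h y - mean (P i) h) ^ 2

/-- Information matrix `𝒞⁽ⁱ⁾`, with entries `∑ y, g j y * g k y / P i y`. -/
noncomputable def infoMatrix {n : ℕ} {Y : Type*} [Fintype Y] (P g : Fin n → Y → ℝ) (i : Fin n) :
    Matrix (Fin n) (Fin n) ℝ :=
  Matrix.of fun j k => ∑ y, g j y * g k y / P i y

/-- Bias vector `𝐛⁽ⁱ⁾`, with entries `∑ y, g j y * (h y - E_i h)`. -/
def biasVec {n : ℕ} {Y : Type*} [Fintype Y] (P g : Fin n → Y → ℝ) (h : Y → ℝ) (i : Fin n) :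
    Fin n → ℝ :=
  fun j => ∑ y, g j y * (h y - mean (P i) h)

/-- The global-score bound `ℬ(A)` of a hierarchy matrix `A`, whose `i`-th column is used at the
`i`-th parameter value. A vanishing denominator forces a vanishing numerator, and the value is
then `0`. -/
noncomputable def scoreBound {n : ℕ} {Y : Type*} [Fintype Y] (w : Fin n → ℝ)
    (P g : Fin n → Y → ℝ) (h : Y → ℝ) (A : Matrix (Fin n) (Fin n) ℝ) : ℝ :=
  (∑ i, w i * ((fun j => A j i) ⬝ᵥ biasVec P g h i)) ^ 2 /
    ∑ i, w i * ((fun j => A j i) ⬝ᵥ (infoMatrix P g i *ᵥ fun j => A j i))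

/-- The fully global bound `∑ i, w i * 𝐛⁽ⁱ⁾ᵀ (𝒞⁽ⁱ⁾)⁺ 𝐛⁽ⁱ⁾`. -/
noncomputable def fullyGlobalBound {n : ℕ} {Y : Type*} [Fintype Y] (w : Fin n → ℝ)
    (P g : Fin n → Y → ℝ) (h : Y → ℝ) : ℝ :=
  ∑ i, w i * (biasVec P g h i ⬝ᵥ (pinv (infoMatrix P g i) *ᵥ biasVec P g h i))

/-- The global Cramér–Rao bound `∑ i, w i * (b⁽ⁱ⁾_i)² / 𝒞⁽ⁱ⁾_ii`. When `𝒞⁽ⁱ⁾_ii = 0` the test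
function `g i` is zero, so `b⁽ⁱ⁾_i = 0`, and the term is `0`. -/
noncomputable def globalCRBound {n : ℕ} {Y : Type*} [Fintype Y] (w : Fin n → ℝ)
    (P g : Fin n → Y → ℝ) (h : Y → ℝ) : ℝ :=
  ∑ i, w i * (biasVec P g h i i ^ 2 / infoMatrix P g i i i)

/-! ### Independent repetitions of a one-parameter model `p x t = p(x|t)` -/

/-- Likelihood `∏ r, p(x_r|t)` of `m` independent repetitions. -/
def jointProb {X : Type*} (p : X → ℝ → ℝ) (m : ℕ) (x : Fin m → X) (t : ℝ) : ℝ :=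
  ∏ r, p (x r) t

/-- The distributions of `m` repetitions at the parameter values `θ i`. -/
def dist_m {n : ℕ} {X : Type*} (p : X → ℝ → ℝ) (θ : Fin n → ℝ) (m : ℕ) :
    Fin n → (Fin m → X) → ℝ :=
  fun i x => jointProb p m x (θ i)

/-- The local scores `∂_θ p(x_1, …, x_m|θ_j)`, used as test functions. -/
noncomputable def score_m {n : ℕ} {X : Type*} (p : X → ℝ → ℝ) (θ : Fin n → ℝ) (m : ℕ) :
    Fin n → (Fin m → X) → ℝ :=
  fun j x => deriv (jointProb p m x) (θ j)

/-- Information matrix `𝒞⁽ⁱ⁾(m)` of `m` repetitions with local scores. -/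
noncomputable def infoRep {n : ℕ} {X : Type*} [Fintype X] (p : X → ℝ → ℝ) (θ : Fin n → ℝ)
    (i : Fin n) (m : ℕ) : Matrix (Fin n) (Fin n) ℝ :=
  infoMatrix (dist_m p θ m) (score_m p θ m) i

/-- `Λ_jk = ∑ x, p(x|θ_j) p(x|θ_k) / p(x|θ_i)`. -/
noncomputable def lam {n : ℕ} {X : Type*} [Fintype X] (p : X → ℝ → ℝ) (θ : Fin n → ℝ)
    (i j k : Fin n) : ℝ :=
  ∑ x, p x (θ j) * p x (θ k) / p x (θ i)

/-- `R_jk = ∑ x, p(x|θ_k) ∂_θ p(x|θ_j) / p(x|θ_i)`. -/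
noncomputable def rCoef {n : ℕ} {X : Type*} [Fintype X] (p : X → ℝ → ℝ) (θ : Fin n → ℝ)
    (i j k : Fin n) : ℝ :=
  ∑ x, p x (θ k) * deriv (p x) (θ j) / p x (θ i)

/-- Classical Fisher information of a single outcome, `∑ x, (∂_θ p(x|t))² / p(x|t)`. -/
noncomputable def fisherInfo {X : Type*} [Fintype X] (p : X → ℝ → ℝ) (t : ℝ) : ℝ :=
  ∑ x, deriv (p x) t ^ 2 / p x t

/-- An estimator for each number `m` of repetitions. -/
abbrev EstimatorSeq (X : Type*) := (m : ℕ) → (Fin m → X) → ℝ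

/-- Weighted variance, fully global bound, global Cramér–Rao bound and the entries `b⁽ⁱ⁾_j` for
the `m`-th estimator of a sequence, with the local scores as test functions. -/
def varRep {n : ℕ} {X : Type*} [Fintype X] (w : Fin n → ℝ) (p : X → ℝ → ℝ) (θ : Fin n → ℝ)
    (est : EstimatorSeq X) (m : ℕ) : ℝ :=
  weightedVar w (dist_m p θ m) (est m)

noncomputable def fgRep {n : ℕ} {X : Type*} [Fintype X] (w : Fin n → ℝ) (p : X → ℝ → ℝ)
    (θ : Fin n → ℝ) (est : EstimatorSeq X) (m : ℕ) : ℝ :=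
  fullyGlobalBound w (dist_m p θ m) (score_m p θ m) (est m)

noncomputable def gcrRep {n : ℕ} {X : Type*} [Fintype X] (w : Fin n → ℝ) (p : X → ℝ → ℝ)
    (θ : Fin n → ℝ) (est : EstimatorSeq X) (m : ℕ) : ℝ :=
  globalCRBound w (dist_m p θ m) (score_m p θ m) (est m)

noncomputable def biasRep {n : ℕ} {X : Type*} [Fintype X] (p : X → ℝ → ℝ)
    (θ : Fin n → ℝ) (est : EstimatorSeq X) (i j : Fin n) (m : ℕ) : ℝ :=
  biasVec (dist_m p θ m) (score_m p θ m) (est m) i j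

/-- `est` is a maximum-likelihood estimator over the parameter set `S`: for all data it is a
maximizer of the likelihood over `S`. -/
def IsMLE {X : Type*} (p : X → ℝ → ℝ) (S : Set ℝ) (est : EstimatorSeq X) : Prop :=
  ∀ (m : ℕ) (x : Fin m → X),
    est m x ∈ S ∧ ∀ t ∈ S, jointProb p m x t ≤ jointProb p m x (est m x)

/-! ### The pseudoinverse of a symmetric matrix -/

/-! The bounds are Cauchy–Schwarz inequalities for the inner product `∑ f g / P i`. `infoMatrix` is
the Gram matrix `C` of the test functions, and `biasVec` pairs them with the centred estimator, so
it lies in the range of `C`. Hence `(aᵀb)² ≤ (aᵀCa)(bᵀC⁺b)`, with equality at `a = C⁺b`, which gives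
the suprema; Cauchy–Schwarz over the outcomes gives the variance bound.

For `m` repetitions, scores at distinct distributions `q`, `q'` become nearly orthogonal: relative
to the diagonal their inner product decays like `m ρ ^ m`, where `ρ < 1` is the cosine of the angle
between `q` and `q'` (`abs_sum_tensorScore_mul_le`, `tensorScore_gram_lower`). Moreover the squared
norm of a score at `q` carries the factor `Λ ^ (m - 1)` with `Λ = ∑ q² / P i`, and `Λ > 1` unless `q
= P i` (`chiSq_overlap`). Scores at other distributions are therefore exponentially expensive, and
`exists_score_quotient_bound` yields `bᵀC⁺b ≤ (b_i² / F_i + o(1) ∑ b_j²) / m`. Working with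
quadratic forms avoids inverting blocks of a possibly singular `C`. The limit of `(C / m)⁺` and the
comparison of the two bounds both follow from this inequality.

For maximum likelihood, data whose empirical distribution is close to `p(·|θ_i)` force the estimator
to be near `θ_i` (`exists_likelihood_lt`). There it solves the likelihood equation, which is linear
in the empirical deviations up to a small relative error (`exists_mle_expansion`). Second and fourth
moments of these deviations (`tendsto_mul_iidSum_sq`) turn this into `m Var → 1 / F_i` and `b_i →
1`; the global Cramér–Rao bound then has the same limit as the variance, and the fully global bound
is squeezed between them. Over a finite parameter set the estimator equals `θ_i` on such data, so `m
Var → 0`, and both bounds lie between `0` and the variance. -/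

theorem pinv_spec {ι κ : Type*} [Fintype ι] [Fintype κ] (A : Matrix ι κ ℝ) :
    IsMoorePenrose A (pinv A) :=
  (exists_isMoorePenrose A).choose_spec

theorem pinv_eq {ι κ : Type*} [Fintype ι] [Fintype κ] {A : Matrix ι κ ℝ} {B : Matrix κ ι ℝ}
    (h : IsMoorePenrose A B) : pinv A = B :=
  (pinv_spec A).unique h

section Symmetric

variable {ι : Type*} [Fintype ι] {C : Matrix ι ι ℝ}

/-- Transposition permutes the four Penrose equations of a symmetric matrix, so uniqueness applies.
-/
theorem pinv_isSymm (hC : C.IsSymm) : (pinv C).IsSymm := by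
  have h := pinv_spec C
  have hC' : Cᵀ = C := hC
  refine (pinv_eq ⟨?_, ?_, ?_, ?_⟩).symm
  · have := congrArg Matrix.transpose h.mul_mul_self
    simpa [Matrix.transpose_mul, hC', Matrix.mul_assoc] using this
  · have := congrArg Matrix.transpose h.self_mul_mul
    simpa [Matrix.transpose_mul, hC', Matrix.mul_assoc] using this
  · have := h.symm_right
    rw [Matrix.transpose_mul, hC'] at this
    rw [this, Matrix.transpose_mul, hC', this]
  · have := h.symm_left
    rw [Matrix.transpose_mul, hC'] at this
    rw [this, Matrix.transpose_mul, hC', this]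

theorem mul_pinv_comm (hC : C.IsSymm) : C * pinv C = pinv C * C := by
  have h := (pinv_spec C).symm_left
  rw [Matrix.transpose_mul, hC, (pinv_isSymm hC : (pinv C)ᵀ = pinv C)] at h
  exact h.symm

theorem pinv_smul (C : Matrix ι ι ℝ) {r : ℝ} (hr : r ≠ 0) : pinv (r • C) = r⁻¹ • pinv C := by
  have h := pinv_spec C
  refine pinv_eq ⟨?_, ?_, ?_, ?_⟩
  · simp [h.mul_mul_self, hr]
  · simp [h.self_mul_mul, hr]
  · simpa [hr] using h.symm_left
  · simpa [hr] using h.symm_right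

theorem dotProduct_mulVec_symm (hC : C.IsSymm) (a b : ι → ℝ) :
    a ⬝ᵥ (C *ᵥ b) = (C *ᵥ a) ⬝ᵥ b := by
  rw [Matrix.dotProduct_mulVec, ← Matrix.mulVec_transpose, hC]

/-- The vector `C⁺ b` realizes the value `bᵀ C⁺ b` of the quadratic form of `C`. -/
theorem quadForm_pinv_mulVec (hC : C.IsSymm) (b : ι → ℝ) :
    (pinv C *ᵥ b) ⬝ᵥ (C *ᵥ (pinv C *ᵥ b)) = b ⬝ᵥ (pinv C *ᵥ b) := by
  rw [← dotProduct_mulVec_symm (pinv_isSymm hC), Matrix.mulVec_mulVec, Matrix.mulVec_mulVec,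
    (pinv_spec C).self_mul_mul]

theorem mulVec_residual (hC : C.IsSymm) (b : ι → ℝ) :
    C *ᵥ (b - C *ᵥ (pinv C *ᵥ b)) = 0 := by
  rw [Matrix.mulVec_sub, Matrix.mulVec_mulVec b, mul_pinv_comm hC, Matrix.mulVec_mulVec,
    ← Matrix.mul_assoc, (pinv_spec C).mul_mul_self, sub_self]

/-- A vector orthogonal to the kernel of a symmetric matrix lies in its range. -/
theorem mulVec_pinv_mulVec (hC : C.IsSymm) {b : ι → ℝ}
    (hb : ∀ a, C *ᵥ a = 0 → a ⬝ᵥ b = 0) : C *ᵥ (pinv C *ᵥ b) = b := by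
  set e := b - C *ᵥ (pinv C *ᵥ b) with he
  have h0 : C *ᵥ e = 0 := mulVec_residual hC b
  -- The residual lies in the kernel, so it is orthogonal to `b` and to the range, hence to itself.
  have h1 : e ⬝ᵥ e = 0 := by
    conv_lhs => rw [he]
    rw [sub_dotProduct, dotProduct_comm, hb e h0, dotProduct_comm, dotProduct_mulVec_symm hC, h0,
      zero_dotProduct, sub_zero]
  have := dotProduct_self_eq_zero.1 h1
  exact (sub_eq_zero.1 this).symm

end Symmetric

/-! ### Gram matrices and the variational description of the bounds -/

section Bounds

variable {n : ℕ} {Y : Type*} [Fintype Y] (w : Fin n → ℝ) (P g : Fin n → Y → ℝ) (h : Y → ℝ)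

theorem infoMatrix_isSymm (i : Fin n) : (infoMatrix P g i).IsSymm := by
  ext j k
  simp [infoMatrix, mul_comm]

theorem dotProduct_infoMatrix (i : Fin n) (a c : Fin n → ℝ) :
    a ⬝ᵥ (infoMatrix P g i *ᵥ c) =
      ∑ y, (∑ j, a j * g j y) * (∑ j, c j * g j y) / P i y := by
  simp only [dotProduct, Matrix.mulVec, infoMatrix, Matrix.of_apply, Finset.mul_sum,
    Finset.sum_mul, Finset.sum_div]
  rw [Finset.sum_comm]
  conv_rhs => rw [Finset.sum_comm]
  refine Finset.sum_congr rfl fun k _ => ?_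
  rw [Finset.sum_comm]
  refine Finset.sum_congr rfl fun y _ => Finset.sum_congr rfl fun j _ => ?_
  ring

theorem quadForm_infoMatrix (i : Fin n) (a : Fin n → ℝ) :
    a ⬝ᵥ (infoMatrix P g i *ᵥ a) = ∑ y, (∑ j, a j * g j y) ^ 2 / P i y := by
  rw [dotProduct_infoMatrix]
  exact Finset.sum_congr rfl fun y _ => by rw [sq]

theorem dotProduct_biasVec (i : Fin n) (a : Fin n → ℝ) :
    a ⬝ᵥ biasVec P g h i = ∑ y, (∑ j, a j * g j y) * (h y - mean (P i) h) := by
  simp only [dotProduct, biasVec, Finset.mul_sum, Finset.sum_mul]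
  rw [Finset.sum_comm]
  exact Finset.sum_congr rfl fun y _ => Finset.sum_congr rfl fun j _ => by ring

variable {P}

theorem quadForm_infoMatrix_nonneg {i : Fin n} (hP : ∀ y, 0 < P i y) (a : Fin n → ℝ) :
    0 ≤ a ⬝ᵥ (infoMatrix P g i *ᵥ a) := by
  rw [quadForm_infoMatrix]
  exact Finset.sum_nonneg fun y _ => div_nonneg (sq_nonneg _) (hP y).le

theorem eq_zero_of_quadForm_eq_zero {i : Fin n} (hP : ∀ y, 0 < P i y) {a : Fin n → ℝ}
    (ha : a ⬝ᵥ (infoMatrix P g i *ᵥ a) = 0) (y : Y) : ∑ j, a j * g j y = 0 := by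
  rw [quadForm_infoMatrix, Finset.sum_eq_zero_iff_of_nonneg
    fun y _ => div_nonneg (sq_nonneg _) (hP y).le] at ha
  have := ha y (Finset.mem_univ _)
  rw [div_eq_zero_iff, or_iff_left (hP y).ne'] at this
  exact pow_eq_zero_iff two_ne_zero |>.1 this

/-- Any vector `b` of the form `b j = ∑ y, g j y * f y` lies in the range of the Gram matrix. -/
theorem infoMatrix_mulVec_pinv {i : Fin n} (hP : ∀ y, 0 < P i y) {b : Fin n → ℝ} (f : Y → ℝ)
    (hb : ∀ j, b j = ∑ y, g j y * f y) :
    infoMatrix P g i *ᵥ (pinv (infoMatrix P g i) *ᵥ b) = b := by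
  refine mulVec_pinv_mulVec (infoMatrix_isSymm P g i) fun a ha => ?_
  have h0 := eq_zero_of_quadForm_eq_zero g hP (a := a) (by rw [ha, dotProduct_zero])
  have : a ⬝ᵥ b = ∑ y, (∑ j, a j * g j y) * f y := by
    simp only [dotProduct, hb, Finset.mul_sum, Finset.sum_mul]
    rw [Finset.sum_comm]
    exact Finset.sum_congr rfl fun y _ => Finset.sum_congr rfl fun j _ => by ring
  rw [this]
  exact Finset.sum_eq_zero fun y _ => by rw [h0, zero_mul]

theorem sq_dotProduct_infoMatrix_le {i : Fin n} (hP : ∀ y, 0 < P i y) (a c : Fin n → ℝ) :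
    (a ⬝ᵥ (infoMatrix P g i *ᵥ c)) ^ 2 ≤
      (a ⬝ᵥ (infoMatrix P g i *ᵥ a)) * (c ⬝ᵥ (infoMatrix P g i *ᵥ c)) := by
  rw [dotProduct_infoMatrix, quadForm_infoMatrix, quadForm_infoMatrix]
  refine Finset.sum_sq_le_sum_mul_sum_of_sq_le_mul _
    (fun y _ => div_nonneg (sq_nonneg _) (hP y).le)
    (fun y _ => div_nonneg (sq_nonneg _) (hP y).le) fun y _ => le_of_eq ?_
  ring

theorem pinv_infoMatrix_nonneg {i : Fin n} (hP : ∀ y, 0 < P i y) (b : Fin n → ℝ) :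
    0 ≤ b ⬝ᵥ (pinv (infoMatrix P g i) *ᵥ b) := by
  rw [← quadForm_pinv_mulVec (infoMatrix_isSymm P g i)]
  exact quadForm_infoMatrix_nonneg g hP _

/-- Cauchy–Schwarz in the form of `C`, against the vector `C⁺ b`, which `C` maps to `b`. -/
theorem sq_dotProduct_le_pinv {i : Fin n} (hP : ∀ y, 0 < P i y) {b : Fin n → ℝ} (f : Y → ℝ)
    (hb : ∀ j, b j = ∑ y, g j y * f y) (a : Fin n → ℝ) :
    (a ⬝ᵥ b) ^ 2 ≤
      (a ⬝ᵥ (infoMatrix P g i *ᵥ a)) * (b ⬝ᵥ (pinv (infoMatrix P g i) *ᵥ b)) := by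
  have := sq_dotProduct_infoMatrix_le g hP a (pinv (infoMatrix P g i) *ᵥ b)
  rwa [quadForm_pinv_mulVec (infoMatrix_isSymm P g i), infoMatrix_mulVec_pinv g hP f hb] at this

/-- An upper bound for `bᵀ C⁺ b` follows from an upper bound for the quotients
`(aᵀ b)² / (aᵀ C a)`. -/
theorem pinv_infoMatrix_le {i : Fin n} (hP : ∀ y, 0 < P i y) {b : Fin n → ℝ} {V : ℝ} (hV : 0 ≤ V)
    (hb : ∀ a : Fin n → ℝ, (a ⬝ᵥ b) ^ 2 ≤ (a ⬝ᵥ (infoMatrix P g i *ᵥ a)) * V) :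
    b ⬝ᵥ (pinv (infoMatrix P g i) *ᵥ b) ≤ V := by
  have h1 := hb (pinv (infoMatrix P g i) *ᵥ b)
  rw [quadForm_pinv_mulVec (infoMatrix_isSymm P g i), dotProduct_comm, sq] at h1
  rcases (pinv_infoMatrix_nonneg g hP b).eq_or_lt with h0 | h0
  · rw [← h0]; exact hV
  · exact le_of_mul_le_mul_left h1 h0

/-- Common source of both suprema. Cauchy–Schwarz over `i` with the weights `w i` gives the upper
bound, and `a₀` attains it, the quotient being `N² / N` for the total `N`. If the total vanishes,
the quotient is `0 / 0 = 0`. -/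
theorem isLUB_quotient {α : Type*} {w : Fin n → ℝ} (hw : ∀ i, 0 ≤ w i) (s q : α → Fin n → ℝ)
    (N : Fin n → ℝ) (hN : ∀ i, 0 ≤ N i) (hq : ∀ a i, 0 ≤ q a i)
    (hle : ∀ a i, s a i ^ 2 ≤ q a i * N i) (a₀ : α) (hs₀ : ∀ i, s a₀ i = N i)
    (hq₀ : ∀ i, q a₀ i = N i) :
    IsLUB (Set.range fun a => (∑ i, w i * s a i) ^ 2 / ∑ i, w i * q a i) (∑ i, w i * N i) := by
  have hN' : 0 ≤ ∑ i, w i * N i := Finset.sum_nonneg fun i _ => mul_nonneg (hw i) (hN i)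
  have hq' : ∀ a, 0 ≤ ∑ i, w i * q a i := fun a =>
    Finset.sum_nonneg fun i _ => mul_nonneg (hw i) (hq a i)
  constructor
  · rintro _ ⟨a, rfl⟩
    refine div_le_of_le_mul₀ (hq' a) hN' ?_
    rw [mul_comm]
    refine Finset.sum_sq_le_sum_mul_sum_of_sq_le_mul _
      (fun i _ => mul_nonneg (hw i) (hq a i)) (fun i _ => mul_nonneg (hw i) (hN i)) fun i _ => ?_
    have := mul_le_mul_of_nonneg_left (hle a i) (sq_nonneg (w i))
    nlinarith
  · intro u hu
    have := hu ⟨a₀, rfl⟩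
    simp only [hs₀, hq₀, sq] at this
    rcases hN'.eq_or_lt with h0 | h0
    · rw [← h0] at this ⊢; simpa using this
    · rwa [mul_div_assoc, div_self h0.ne', mul_one] at this

variable {w}

theorem isLUB_fullyGlobalBound (hw : ∀ i, 0 ≤ w i) (hP : ∀ i y, 0 < P i y) :
    IsLUB (Set.range fun A : Matrix (Fin n) (Fin n) ℝ => scoreBound w P g h A)
      (fullyGlobalBound w P g h) := by
  refine isLUB_quotient hw
    (fun (A : Matrix (Fin n) (Fin n) ℝ) i => (fun j => A j i) ⬝ᵥ biasVec P g h i)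
    (fun A i => (fun j => A j i) ⬝ᵥ (infoMatrix P g i *ᵥ fun j => A j i))
    _ (fun i => pinv_infoMatrix_nonneg g (hP i) _)
    (fun A i => quadForm_infoMatrix_nonneg g (hP i) _)
    (fun A i => sq_dotProduct_le_pinv g (hP i) _ (fun j => rfl) _)
    (fun j i => (pinv (infoMatrix P g i) *ᵥ biasVec P g h i) j)
    (fun i => dotProduct_comm _ _)
    (fun i => quadForm_pinv_mulVec (infoMatrix_isSymm P g i) _)

theorem infoMatrix_diag (i : Fin n) : infoMatrix P g i i i = ∑ y, g i y ^ 2 / P i y := by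
  simp [infoMatrix, sq]

/-- A diagonal `A` restricts the `i`-th column to multiples of the `i`-th basis vector, so each term
is a one-dimensional problem in `a i`, with optimum `b / C` at the diagonal entry. -/
theorem isLUB_globalCRBound (hw : ∀ i, 0 ≤ w i) (hP : ∀ i y, 0 < P i y) :
    IsLUB (Set.range fun a : Fin n → ℝ => scoreBound w P g h (Matrix.diagonal a))
      (globalCRBound w P g h) := by
  have hcol : ∀ (a : Fin n → ℝ) (i : Fin n),
      (fun j => Matrix.diagonal a j i) = Pi.single i (a i) := by
    intro a i
    ext j
    by_cases hj : j = i
    · subst hj; simp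
    · simp [hj]
  have hC : ∀ i, 0 ≤ infoMatrix P g i i i := fun i => by
    rw [infoMatrix_diag]
    exact Finset.sum_nonneg fun y _ => div_nonneg (sq_nonneg _) (hP i y).le
  have hb0 : ∀ i, infoMatrix P g i i i = 0 → biasVec P g h i i = 0 := by
    intro i h0
    have := eq_zero_of_quadForm_eq_zero g (hP i) (a := Pi.single i 1) (by simp [h0])
    simp only [biasVec]
    refine Finset.sum_eq_zero fun y _ => ?_
    have hy := this y
    simp only [Pi.single_apply, ite_mul, one_mul, zero_mul, Finset.sum_ite_eq',
      Finset.mem_univ, if_true] at hy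
    rw [hy, zero_mul]
  have hS : ∀ a : Fin n → ℝ, scoreBound w P g h (Matrix.diagonal a) =
      (∑ i, w i * (a i * biasVec P g h i i)) ^ 2 /
        ∑ i, w i * (a i * (infoMatrix P g i i i * a i)) := by
    intro a
    unfold scoreBound
    simp only [hcol, single_dotProduct, Matrix.mulVec_single]
    rfl
  simp only [hS]
  refine isLUB_quotient hw (fun (a : Fin n → ℝ) i => a i * biasVec P g h i i)
    (fun a i => a i * (infoMatrix P g i i i * a i))
    (fun i => biasVec P g h i i ^ 2 / infoMatrix P g i i i)
    (fun i => div_nonneg (sq_nonneg _) (hC i)) ?_ ?_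
    (fun i => biasVec P g h i i / infoMatrix P g i i i) ?_ ?_
  · intro a i
    nlinarith [mul_nonneg (sq_nonneg (a i)) (hC i)]
  · intro a i
    by_cases h0 : infoMatrix P g i i i = 0
    · simp [hb0 i h0]
    · refine le_of_eq ?_
      field_simp
  · intro i; ring
  · intro i
    by_cases h0 : infoMatrix P g i i i = 0
    · simp [h0]
    · field_simp

theorem globalCRBound_le_fullyGlobalBound (hw : ∀ i, 0 ≤ w i) (hP : ∀ i y, 0 < P i y) :
    globalCRBound w P g h ≤ fullyGlobalBound w P g h := by
  refine (isLUB_globalCRBound g h hw hP).2 ?_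
  rintro _ ⟨a, rfl⟩
  exact (isLUB_fullyGlobalBound g h hw hP).1 ⟨_, rfl⟩

/-- Cauchy–Schwarz over the outcomes, splitting `g * (h - E h)` as `(g / √P) * (√P * (h - E h))`:
the variance bounds every quotient `(aᵀb)² / (aᵀCa)`. -/
theorem fullyGlobalBound_le_weightedVar (hw : ∀ i, 0 ≤ w i) (hP : ∀ i y, 0 < P i y) :
    fullyGlobalBound w P g h ≤ weightedVar w P h := by
  refine Finset.sum_le_sum fun i _ => mul_le_mul_of_nonneg_left ?_ (hw i)
  refine pinv_infoMatrix_le g (hP i)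
    (Finset.sum_nonneg fun y _ => mul_nonneg (hP i y).le (sq_nonneg _)) fun a => ?_
  rw [dotProduct_biasVec, quadForm_infoMatrix]
  refine Finset.sum_sq_le_sum_mul_sum_of_sq_le_mul _
    (fun y _ => div_nonneg (sq_nonneg _) (hP i y).le)
    (fun y _ => mul_nonneg (hP i y).le (sq_nonneg _)) fun y _ => le_of_eq ?_
  have := (hP i y).ne'
  field_simp

theorem globalCRBound_nonneg (hw : ∀ i, 0 ≤ w i) (hP : ∀ i y, 0 < P i y) :
    0 ≤ globalCRBound w P g h := by
  refine Finset.sum_nonneg fun i _ => mul_nonneg (hw i) (div_nonneg (sq_nonneg _) ?_)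
  rw [infoMatrix_diag]
  exact Finset.sum_nonneg fun y _ => div_nonneg (sq_nonneg _) (hP i y).le

end Bounds

/-! ### The chi-square overlap -/

/-- Both masses being one, `∑ Q² / P - 1 = ∑ (Q - P)² / P`. This excess is what later makes the
norms of scores at `Q ≠ P` grow exponentially. -/
theorem chiSq_overlap {X : Type*} [Fintype X] (P Q : X → ℝ) (hP : ∀ x, 0 ≤ P x)
    (hQ : ∀ x, 0 ≤ Q x) (hP1 : ∑ x, P x = 1) (hQ1 : ∑ x, Q x = 1)
    (hPQ : ∀ x, 0 < Q x → 0 < P x) :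
    1 ≤ ∑ x, Q x ^ 2 / P x ∧ (∑ x, Q x ^ 2 / P x = 1 ↔ Q = P) := by
  have key : ∑ x, Q x ^ 2 / P x = 1 + ∑ x, (Q x - P x) ^ 2 / P x := by
    have : ∀ x, Q x ^ 2 / P x = (2 * Q x - P x) + (Q x - P x) ^ 2 / P x := by
      intro x
      rcases (hP x).eq_or_lt with h | h
      · have : Q x = 0 := by
          by_contra h'
          have := hPQ x (lt_of_le_of_ne (hQ x) (Ne.symm h'))
          linarith
        simp [this, ← h]
      · field_simp; ring
    rw [Finset.sum_congr rfl fun x _ => this x, Finset.sum_add_distrib, Finset.sum_sub_distrib,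
      ← Finset.mul_sum, hP1, hQ1]
    norm_num
  have h0 : ∀ x ∈ Finset.univ, 0 ≤ (Q x - P x) ^ 2 / P x := fun x _ =>
    div_nonneg (sq_nonneg _) (hP x)
  refine ⟨by rw [key]; linarith [Finset.sum_nonneg h0], ?_, ?_⟩
  · intro h
    rw [key, add_eq_left, Finset.sum_eq_zero_iff_of_nonneg h0] at h
    ext x
    have hx := h x (Finset.mem_univ _)
    rcases div_eq_zero_iff.1 hx with h' | h'
    · exact sub_eq_zero.1 (pow_eq_zero_iff two_ne_zero |>.1 h')
    · by_contra hne
      have := hPQ x (lt_of_le_of_ne (hQ x) fun h => hne (by rw [← h, h']))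
      linarith
  · rintro rfl
    rw [key]; simp

/-! ### Pseudoinverses of bordered matrices -/

/-- The pseudoinverse of a bordered symmetric matrix with nonzero Schur complement. -/
theorem isMoorePenrose_fromBlocks {ι : Type*} [Fintype ι] {D E : Matrix ι ι ℝ}
    (hDE : IsMoorePenrose D E) (hE : Eᵀ = E) (hD : Dᵀ = D) {V y : Matrix ι Unit ℝ}
    (hy : E * V = y) (hV : D * y = V) {c s : ℝ} (hs : s ≠ 0)
    (hsc : Vᵀ * y = (c - s) • (1 : Matrix Unit Unit ℝ)) :
    IsMoorePenrose (fromBlocks D V Vᵀ (c • (1 : Matrix Unit Unit ℝ)))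
      (fromBlocks (E + s⁻¹ • (y * yᵀ)) (-(s⁻¹ • y)) (-(s⁻¹ • yᵀ)) (s⁻¹ • (1 : Matrix Unit Unit ℝ)))
      := by
  classical
  set M := fromBlocks D V Vᵀ (c • (1 : Matrix Unit Unit ℝ)) with hM
  set B := fromBlocks (E + s⁻¹ • (y * yᵀ)) (-(s⁻¹ • y)) (-(s⁻¹ • yᵀ))
    (s⁻¹ • (1 : Matrix Unit Unit ℝ)) with hB
  have hyT : Vᵀ * E = yᵀ := by rw [← hy, Matrix.transpose_mul, hE]
  -- By `D y = V` and the Schur complement `s = c - Vᵀ y`, the product is block diagonal, hence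
  -- symmetric; transposing then gives `B * M = M * B`, and all four equations reduce to those for
  -- `D`.
  have hMB : M * B = fromBlocks (D * E) 0 0 1 := by
    rw [hM, hB, fromBlocks_multiply]
    congr 1
    · rw [Matrix.mul_add, Matrix.mul_smul, ← Matrix.mul_assoc, hV]; simp
    · simp [hV]
    · rw [Matrix.mul_add, Matrix.mul_smul, ← Matrix.mul_assoc, hsc, hyT]
      ext a b
      simp only [Matrix.smul_mul, Matrix.one_mul, Matrix.add_apply, Matrix.smul_apply,
        Matrix.mul_neg, Matrix.neg_apply, Matrix.mul_smul, smul_eq_mul, Matrix.zero_apply]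
      field_simp
      ring
    · rw [Matrix.mul_neg, Matrix.mul_smul, hsc]
      ext a b
      simp only [Matrix.smul_mul, Matrix.one_mul, Matrix.add_apply, Matrix.smul_apply,
        Matrix.neg_apply, Matrix.mul_smul, smul_eq_mul, Matrix.one_apply_eq]
      field_simp
      ring
  have hMT : Mᵀ = M := by simp [hM, fromBlocks_transpose, hD]
  have hBT : Bᵀ = B := by simp [hB, fromBlocks_transpose, hE, Matrix.transpose_mul]
  have hMBT : (M * B)ᵀ = M * B := by
    rw [hMB, fromBlocks_transpose, hDE.symm_left]; simp
  have hBM : B * M = M * B := by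
    conv_lhs => rw [← hBT, ← hMT, ← Matrix.transpose_mul, hMBT]
  have hcomm : D * E = E * D := by
    have := hDE.symm_left
    rwa [Matrix.transpose_mul, hD, hE, eq_comm] at this
  refine ⟨?_, ?_, hMBT, by rw [hBM, hMBT]⟩
  · rw [hMB, hM, fromBlocks_multiply]
    simp [hDE.mul_mul_self, Matrix.mul_assoc, hy, hV]
  · rw [hBM, hMB, hB, fromBlocks_multiply]
    have h1 : D * E * y = y := by rw [hcomm, Matrix.mul_assoc, hV, hy]
    have h2 : D * E * E = E := by rw [hcomm, hDE.self_mul_mul]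
    simp [Matrix.mul_add, ← Matrix.mul_assoc, h1, h2]

/-- With `y = D⁺ v` and `τ = vᵀ y`, both tending to zero, the Schur complement `c - τ` stays away
from zero eventually. The explicit pseudoinverse then applies; each block of the difference is a
product of bounded and null sequences, the corner being `1 / (c - τ) - 1 / c = τ / ((c - τ) c)`. -/
theorem tendsto_pinv_fromBlocks (k : ℕ) (D : ℕ → Matrix (Fin k) (Fin k) ℝ) (v : ℕ → Fin k → ℝ)
    (c : ℕ → ℝ) (hD : ∀ m, (D m).IsSymm) (hv : ∀ m, ∃ u, D m *ᵥ u = v m)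
    (hlim : Tendsto (fun m => pinv (D m)) atTop (𝓝 0)) (hbd : ∃ B, ∀ m j, |v m j| ≤ B)
    (hc : ∃ ε > 0, ∀ m, ε ≤ |c m|) :
    Tendsto (fun m =>
        pinv (Matrix.fromBlocks (D m) (Matrix.replicateCol Unit (v m))
          (Matrix.replicateRow Unit (v m)) (Matrix.of fun _ _ => c m)) -
        Matrix.fromBlocks 0 0 0 (Matrix.of fun _ _ => 1 / c m)) atTop (𝓝 0) := by
  obtain ⟨B, hB⟩ := hbd
  obtain ⟨ε, hε, hcε⟩ := hc
  set y : ℕ → Fin k → ℝ := fun m => pinv (D m) *ᵥ v m with hy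
  set τ : ℕ → ℝ := fun m => v m ⬝ᵥ y m with hτ
  have hvO : ∀ j, (fun m => v m j) =O[atTop] fun _ => (1 : ℝ) := fun j =>
    isBigO_of_le' (c := B) _ fun m => by simpa using hB m j
  have hE : ∀ j l, (fun m => pinv (D m) j l) =o[atTop] fun _ => (1 : ℝ) := fun j l =>
    (isLittleO_one_iff ℝ).2 (tendsto_pi_nhds.1 (tendsto_pi_nhds.1 hlim j) l)
  have hyo : ∀ j, (fun m => y m j) =o[atTop] fun _ => (1 : ℝ) := fun j => by
    simp only [hy, Matrix.mulVec, dotProduct]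
    exact IsLittleO.fun_sum fun l _ => by simpa using (hE j l).mul_isBigO (hvO l)
  have hτo : τ =o[atTop] fun _ => (1 : ℝ) := by
    simp only [hτ, dotProduct]
    exact IsLittleO.fun_sum fun l _ => by simpa using (hvO l).mul_isLittleO (hyo l)
  have hτ0 : Tendsto τ atTop (𝓝 0) := (isLittleO_one_iff ℝ).1 hτo
  have hsev : ∀ᶠ m in atTop, ε / 2 ≤ |c m - τ m| := by
    have := hτ0.abs.eventually_lt_const (u := ε / 2) (by rw [abs_zero]; positivity)
    filter_upwards [this] with m hm
    have h1 := abs_sub_abs_le_abs_sub (c m) (τ m)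
    linarith [hcε m]
  have hsO : (fun m => (c m - τ m)⁻¹) =O[atTop] fun _ => (1 : ℝ) := by
    refine IsBigO.of_bound (2 / ε) ?_
    filter_upwards [hsev] with m hm
    rw [norm_inv, Real.norm_eq_abs, norm_one, mul_one, ← inv_div]
    exact inv_anti₀ (by positivity) hm
  have hcO : (fun m => (c m)⁻¹) =O[atTop] fun _ => (1 : ℝ) := by
    refine isBigO_of_le' (c := ε⁻¹) _ fun m => ?_
    rw [norm_inv, Real.norm_eq_abs, norm_one, mul_one]
    exact inv_anti₀ hε (hcε m)
  have hev : ∀ᶠ m in atTop, pinv (Matrix.fromBlocks (D m) (Matrix.replicateCol Unit (v m))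
          (Matrix.replicateRow Unit (v m)) (Matrix.of fun _ _ => c m)) -
        Matrix.fromBlocks 0 0 0 (Matrix.of fun _ _ => 1 / c m) =
      fromBlocks (Matrix.of fun i j => pinv (D m) i j + (c m - τ m)⁻¹ * (y m i * y m j))
        (Matrix.of fun i _ => -((c m - τ m)⁻¹ * y m i))
        (Matrix.of fun _ i => -((c m - τ m)⁻¹ * y m i))
        (Matrix.of fun _ _ => τ m * (c m - τ m)⁻¹ * (c m)⁻¹) := by
    filter_upwards [hsev] with m hm
    have hs : c m - τ m ≠ 0 := by
      intro h; rw [h, abs_zero] at hm; linarith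
    have hc0 : c m ≠ 0 := by
      intro h; have := hcε m; rw [h, abs_zero] at this; linarith
    have hDy : D m *ᵥ y m = v m := by
      obtain ⟨u, hu⟩ := hv m
      rw [hy]
      simp only
      rw [← hu, Matrix.mulVec_mulVec, Matrix.mulVec_mulVec,
        (pinv_spec (D m)).mul_mul_self]
    have hcm : (Matrix.of fun _ _ => c m : Matrix Unit Unit ℝ) = c m • 1 := by
      ext a b; simp
    have := isMoorePenrose_fromBlocks (pinv_spec (D m)) (pinv_isSymm (hD m)) (hD m)
      (V := Matrix.replicateCol Unit (v m)) (y := Matrix.replicateCol Unit (y m)) (c := c m)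
      (by rw [← Matrix.replicateCol_mulVec]) (by rw [← Matrix.replicateCol_mulVec, hDy]) hs
      (by ext a b; simp [Matrix.mul_apply, hτ, dotProduct])
    rw [Matrix.transpose_replicateCol] at this
    rw [hcm, pinv_eq this]
    ext (a | a) (b | b)
    · simp [Matrix.mul_apply]
    · simp
    · simp
    · simp
      field_simp
      ring
  refine Tendsto.congr' (EventuallyEq.symm hev) ?_
  refine tendsto_pi_nhds.2 fun a => tendsto_pi_nhds.2 fun b => ?_
  refine (isLittleO_one_iff ℝ).1 ?_
  rcases a with a | a <;> rcases b with b | b <;>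
    simp only [fromBlocks_apply₁₁, fromBlocks_apply₁₂, fromBlocks_apply₂₁, fromBlocks_apply₂₂,
      Matrix.of_apply]
  · exact (hE a b).add (by simpa using hsO.mul_isLittleO ((hyo a).mul (hyo b)))
  · exact IsLittleO.neg_left (by simpa using hsO.mul_isLittleO (hyo a))
  · exact IsLittleO.neg_left (by simpa using hsO.mul_isLittleO (hyo b))
  · simpa using (hτo.mul_isBigO hsO).mul_isBigO hcO

/-! ### Moments of sums over product weights -/

section Moments

variable {X : Type*} [Fintype X]

/-- The sum of `F` over `X ^ m` against the product weight `∏ r, A (x r)`. -/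
def iidSum (A : X → ℝ) (m : ℕ) (F : (Fin m → X) → ℝ) : ℝ :=
  ∑ x : Fin m → X, (∏ r, A (x r)) * F x

variable (A : X → ℝ)

theorem iidSum_zero (F : (Fin 0 → X) → ℝ) : iidSum A 0 F = F Fin.elim0 := by
  simp only [iidSum, Finset.univ_unique, Finset.univ_eq_empty, Finset.prod_empty, one_mul,
    Finset.sum_singleton]
  exact congrArg F (Subsingleton.elim _ _)

theorem iidSum_succ (m : ℕ) (F : (Fin (m + 1) → X) → ℝ) :
    iidSum A (m + 1) F = ∑ a, A a * iidSum A m fun x => F (Fin.cons a x) := by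
  unfold iidSum
  rw [← (Fin.consEquiv fun _ : Fin (m + 1) => X).sum_comp, Fintype.sum_prod_type]
  refine Finset.sum_congr rfl fun a _ => ?_
  rw [Finset.mul_sum]
  refine Finset.sum_congr rfl fun x _ => ?_
  simp only [Fin.consEquiv, Equiv.coe_fn_mk, Fin.prod_univ_succ, Fin.cons_zero, Fin.cons_succ]
  ring

theorem iidSum_add (m : ℕ) (F G : (Fin m → X) → ℝ) :
    iidSum A m (fun x => F x + G x) = iidSum A m F + iidSum A m G := by
  simp only [iidSum, mul_add, Finset.sum_add_distrib]

theorem iidSum_const_mul (m : ℕ) (c : ℝ) (F : (Fin m → X) → ℝ) :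
    iidSum A m (fun x => c * F x) = c * iidSum A m F := by
  simp only [iidSum, Finset.mul_sum]
  exact Finset.sum_congr rfl fun x _ => by ring

theorem iidSum_finsetSum {ι : Type*} (s : Finset ι) (m : ℕ) (F : ι → (Fin m → X) → ℝ) :
    iidSum A m (fun x => ∑ z ∈ s, F z x) = ∑ z ∈ s, iidSum A m (F z) := by
  simp only [iidSum, Finset.mul_sum]
  exact Finset.sum_comm

theorem iidSum_const (m : ℕ) (c : ℝ) : iidSum A m (fun _ => c) = c * (∑ a, A a) ^ m := by
  induction m with
  | zero => simp [iidSum_zero]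
  | succ m ih =>
    rw [iidSum_succ]
    simp only [ih, ← Finset.sum_mul]
    ring

variable {A}

theorem iidSum_mono (hA : ∀ a, 0 ≤ A a) {m : ℕ} {F G : (Fin m → X) → ℝ} (h : ∀ x, F x ≤ G x) :
    iidSum A m F ≤ iidSum A m G :=
  Finset.sum_le_sum fun x _ =>
    mul_le_mul_of_nonneg_left (h x) (Finset.prod_nonneg fun r _ => hA (x r))

variable (A)

theorem iidSum_sum (m : ℕ) (α : X → ℝ) :
    iidSum A m (fun x => ∑ r, α (x r)) = m * (∑ a, A a) ^ (m - 1) * ∑ a, A a * α a := by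
  induction m with
  | zero => simp [iidSum_zero]
  | succ m ih =>
    rw [iidSum_succ]
    simp only [Fin.sum_univ_succ, Fin.cons_zero, Fin.cons_succ, iidSum_add, iidSum_const, ih,
      mul_add, Finset.sum_add_distrib, ← Finset.sum_mul]
    rw [Finset.sum_congr rfl fun a _ => (mul_assoc (A a) (α a) _).symm, ← Finset.sum_mul]
    rcases m with _ | m
    · simp
    · push_cast
      simp only [pow_succ]
      ring

/-- Induction splitting off one outcome. `A` is not assumed normalized because it will be `q q' /
P`, whose total mass is `Λ`; this is how the powers of `Λ` enter the information matrix. -/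
theorem iidSum_sum_mul_sum (m : ℕ) (α β : X → ℝ) :
    iidSum A m (fun x => (∑ r, α (x r)) * ∑ r, β (x r)) =
      (m : ℝ) * ((m : ℝ) - 1) * (∑ a, A a) ^ (m - 2) * ((∑ a, A a * α a) * ∑ a, A a * β a) +
        (m : ℝ) * (∑ a, A a) ^ (m - 1) * ∑ a, A a * (α a * β a) := by
  induction m with
  | zero => simp [iidSum_zero]
  | succ m ih =>
    rw [iidSum_succ]
    have h1 : ∀ a, A a * iidSum A m (fun x : Fin m → X =>
        (∑ r, α ((Fin.cons a x : Fin (m + 1) → X) r)) *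
          ∑ r, β ((Fin.cons a x : Fin (m + 1) → X) r)) =
        A a * (α a * β a) * (∑ a, A a) ^ m +
          A a * α a * (m * (∑ a, A a) ^ (m - 1) * ∑ a, A a * β a) +
          A a * β a * (m * (∑ a, A a) ^ (m - 1) * ∑ a, A a * α a) +
          A a * iidSum A m (fun x => (∑ r, α (x r)) * ∑ r, β (x r)) := by
      intro a
      have : ∀ x : Fin m → X, (∑ r, α ((Fin.cons a x : Fin (m + 1) → X) r)) *
          (∑ r, β ((Fin.cons a x : Fin (m + 1) → X) r)) =
          α a * β a + α a * (∑ r, β (x r)) + β a * (∑ r, α (x r)) +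
            (∑ r, α (x r)) * ∑ r, β (x r) := by
        intro x
        simp only [Fin.sum_univ_succ, Fin.cons_zero, Fin.cons_succ]
        ring
      simp only [this, iidSum_add, iidSum_const_mul, iidSum_const, iidSum_sum]
      ring
    simp only [h1, Finset.sum_add_distrib, ← Finset.sum_mul, ih]
    -- The truncated exponents `m - 1` and `m - 2` are genuine only from `m = 2` on; below that
    -- their coefficients vanish.
    rcases m with _ | _ | m
    · simp
    · simp; ring
    · push_cast
      simp only [Nat.add_assoc, Nat.reduceAdd, pow_succ]
      ring

variable {A}

theorem iidSum_sq_of_centered (hA : ∑ a, A a = 1) {α : X → ℝ} (hα : ∑ a, A a * α a = 0) (m : ℕ) :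
    iidSum A m (fun x => (∑ r, α (x r)) ^ 2) = m * ∑ a, A a * α a ^ 2 := by
  simp only [sq, iidSum_sum_mul_sum, hA, hα, one_pow]
  ring

/-- In the expansion all terms with an isolated first power of `α` have mean zero. One more outcome
adds at most `1 + 6 m`, which is below `3 (m + 1)² - 3 m²`. -/
theorem iidSum_pow_four_le (hA0 : ∀ a, 0 ≤ A a) (hA : ∑ a, A a = 1) {α : X → ℝ}
    (hα : ∑ a, A a * α a = 0) (hα1 : ∀ a, |α a| ≤ 1) (m : ℕ) :
    iidSum A m (fun x => (∑ r, α (x r)) ^ 4) ≤ 3 * (m : ℝ) ^ 2 := by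
  have hle : ∀ k : ℕ, ∑ a, A a * α a ^ (2 * k) ≤ 1 := by
    intro k
    rw [← hA]
    refine Finset.sum_le_sum fun a _ => mul_le_of_le_one_right (hA0 a) ?_
    rw [pow_mul, ← sq_abs]
    exact pow_le_one₀ (sq_nonneg _) (pow_le_one₀ (abs_nonneg _) (hα1 a))
  have hσ : ∑ a, A a * α a ^ 2 ≤ 1 := hle 1
  have hμ : ∑ a, A a * α a ^ 4 ≤ 1 := hle 2
  induction m with
  | zero => simp [iidSum_zero]
  | succ m ih =>
    rw [iidSum_succ]
    have h1 : ∀ a, A a * iidSum A m (fun x : Fin m → X =>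
        (∑ r, α ((Fin.cons a x : Fin (m + 1) → X) r)) ^ 4) =
        A a * α a ^ 4 + A a * α a ^ 2 * (6 * (m * ∑ a, A a * α a ^ 2)) +
          A a * α a * (4 * iidSum A m (fun x => (∑ r, α (x r)) ^ 3)) +
          A a * iidSum A m (fun x => (∑ r, α (x r)) ^ 4) := by
      intro a
      have : ∀ x : Fin m → X, (∑ r, α ((Fin.cons a x : Fin (m + 1) → X) r)) ^ 4 =
          α a ^ 4 + 4 * α a ^ 3 * (∑ r, α (x r)) + 6 * α a ^ 2 * (∑ r, α (x r)) ^ 2 +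
            4 * α a * (∑ r, α (x r)) ^ 3 + (∑ r, α (x r)) ^ 4 := by
        intro x
        simp only [Fin.sum_univ_succ, Fin.cons_zero, Fin.cons_succ]
        ring
      simp only [this, iidSum_add, iidSum_const_mul, iidSum_const, iidSum_sum,
        iidSum_sq_of_centered hA hα, hA, hα, one_pow]
      ring
    simp only [h1, Finset.sum_add_distrib, ← Finset.sum_mul, hA, hα, zero_mul, one_mul, add_zero]
    push_cast
    have h0 : 0 ≤ ∑ a, A a * α a ^ 2 :=
      Finset.sum_nonneg fun a _ => mul_nonneg (hA0 a) (sq_nonneg _)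
    have h2 : (∑ a, A a * α a ^ 2) * (6 * (m * ∑ a, A a * α a ^ 2)) ≤ 6 * m := by
      have hm : (0 : ℝ) ≤ m := m.cast_nonneg
      have : (∑ a, A a * α a ^ 2) * ∑ a, A a * α a ^ 2 ≤ 1 := mul_le_one₀ hσ h0 hσ
      nlinarith
    nlinarith

end Moments

/-! ### Scores of independent repetitions -/

section Scores

variable {X : Type*} {n : ℕ} {p : X → ℝ → ℝ} {θ : Fin n → ℝ}

theorem hasDerivAt_jointProb {t : ℝ} (hpos : ∀ x, 0 < p x t)
    (hdiff : ∀ x, DifferentiableAt ℝ (p x) t) (m : ℕ) (x : Fin m → X) :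
    HasDerivAt (jointProb p m x)
      ((∏ r, p (x r) t) * ∑ r, deriv (p (x r)) t / p (x r) t) t := by
  have h := HasDerivAt.fun_finsetProd (u := Finset.univ) (f := fun r => p (x r))
    (f' := fun r => deriv (p (x r)) t) (x := t) fun r _ => (hdiff (x r)).hasDerivAt
  refine HasDerivAt.congr_deriv (f := jointProb p m x) h ?_
  rw [Finset.mul_sum]
  refine Finset.sum_congr rfl fun r _ => ?_
  rw [smul_eq_mul, ← Finset.mul_prod_erase _ _ (Finset.mem_univ r)]
  have := (hpos (x r)).ne'
  field_simp

theorem score_m_eq (hpos : ∀ i x, 0 < p x (θ i)) (hdiff : ∀ i x, DifferentiableAt ℝ (p x) (θ i))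
    (m : ℕ) (j : Fin n) (x : Fin m → X) :
    score_m p θ m j x =
      (∏ r, p (x r) (θ j)) * ∑ r, deriv (p (x r)) (θ j) / p (x r) (θ j) :=
  (hasDerivAt_jointProb (hpos j) (hdiff j) m x).deriv

theorem dist_m_pos (hpos : ∀ i x, 0 < p x (θ i)) (m : ℕ) (i : Fin n) (x : Fin m → X) :
    0 < dist_m p θ m i x := by
  unfold dist_m jointProb
  exact Finset.prod_pos fun r _ => hpos i (x r)

variable [Fintype X]

/-- The inner product of two local score directions over repetitions. -/
theorem sum_tensor_mul_tensor (P : X → ℝ) {q q' : X → ℝ} (hq : ∀ x, 0 < q x)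
    (hq' : ∀ x, 0 < q' x) (u u' : X → ℝ) (m : ℕ) :
    ∑ x : Fin m → X, ((∏ r, q (x r)) * ∑ r, u (x r) / q (x r)) *
        ((∏ r, q' (x r)) * ∑ r, u' (x r) / q' (x r)) / ∏ r, P (x r) =
      (m : ℝ) * ((m : ℝ) - 1) * (∑ a, q a * q' a / P a) ^ (m - 2) *
          ((∑ a, q' a * u a / P a) * ∑ a, q a * u' a / P a) +
        (m : ℝ) * (∑ a, q a * q' a / P a) ^ (m - 1) * ∑ a, u a * u' a / P a := by
  have h := iidSum_sum_mul_sum (fun a => q a * q' a / P a) m (fun a => u a / q a)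
    (fun a => u' a / q' a)
  have e1 : ∀ a, q a * q' a / P a * (u a / q a) = q' a * u a / P a := fun a => by
    have := (hq a).ne'; field_simp
  have e2 : ∀ a, q a * q' a / P a * (u' a / q' a) = q a * u' a / P a := fun a => by
    have := (hq' a).ne'; field_simp
  have e3 : ∀ a, q a * q' a / P a * (u a / q a * (u' a / q' a)) = u a * u' a / P a := fun a => by
    have := (hq' a).ne'; have := (hq a).ne'; field_simp
  simp only [e1, e2, e3] at h
  rw [← h]
  refine Finset.sum_congr rfl fun x _ => ?_
  rw [Finset.prod_div_distrib, Finset.prod_mul_distrib]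
  ring

theorem infoRep_eq_aux (hpos : ∀ i x, 0 < p x (θ i))
    (hdiff : ∀ i x, DifferentiableAt ℝ (p x) (θ i)) (m : ℕ) (i j k : Fin n) :
    infoRep p θ i m j k =
      (m : ℝ) * ((m : ℝ) - 1) * lam p θ i j k ^ (m - 2) * (rCoef p θ i j k * rCoef p θ i k j) +
        (m : ℝ) * lam p θ i j k ^ (m - 1) *
          ∑ x, deriv (p x) (θ j) * deriv (p x) (θ k) / p x (θ i) := by
  have h := sum_tensor_mul_tensor (fun x => p x (θ i)) (q := fun x => p x (θ j))
    (q' := fun x => p x (θ k)) (hpos j) (hpos k) (fun x => deriv (p x) (θ j))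
    (fun x => deriv (p x) (θ k)) m
  unfold lam rCoef
  rw [← h]
  simp only [infoRep, infoMatrix, Matrix.of_apply, score_m_eq hpos hdiff]
  rfl

theorem infoRep_one (hpos : ∀ i x, 0 < p x (θ i))
    (hdiff : ∀ i x, DifferentiableAt ℝ (p x) (θ i)) (i j k : Fin n) :
    infoRep p θ i 1 j k = ∑ x, deriv (p x) (θ j) * deriv (p x) (θ k) / p x (θ i) := by
  rw [infoRep_eq_aux hpos hdiff]; simp

theorem infoRep_eq (hpos : ∀ i x, 0 < p x (θ i))
    (hdiff : ∀ i x, DifferentiableAt ℝ (p x) (θ i)) (m : ℕ) (i j k : Fin n) :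
    infoRep p θ i m j k =
      (m : ℝ) * ((m : ℝ) - 1) * lam p θ i j k ^ (m - 2) * (rCoef p θ i j k * rCoef p θ i k j) +
        (m : ℝ) * lam p θ i j k ^ (m - 1) * infoRep p θ i 1 j k := by
  rw [infoRep_eq_aux hpos hdiff, infoRep_one hpos hdiff]

theorem sum_deriv_eq_zero {t : ℝ} (hsum : ∀ᶠ s in 𝓝 t, ∑ x, p x s = 1)
    (hdiff : ∀ x, DifferentiableAt ℝ (p x) t) : ∑ x, deriv (p x) t = 0 := by
  have h1 : HasDerivAt (fun s => ∑ x, p x s) (∑ x, deriv (p x) t) t :=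
    HasDerivAt.fun_sum fun x _ => (hdiff x).hasDerivAt
  have h2 : HasDerivAt (fun s => ∑ x, p x s) 0 t :=
    (hasDerivAt_const t (1 : ℝ)).congr_of_eventuallyEq hsum
  exact h1.unique h2

/-- Additivity of Fisher information: on the diagonal `Λ = 1`, and `R = 0` because the derivatives
sum to zero. -/
theorem infoRep_diag (hpos : ∀ i x, 0 < p x (θ i))
    (hdiff : ∀ i x, DifferentiableAt ℝ (p x) (θ i)) {i : Fin n} (h1 : ∑ x, p x (θ i) = 1)
    (h0 : ∑ x, deriv (p x) (θ i) = 0) (m : ℕ) :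
    infoRep p θ i m i i = m * fisherInfo p (θ i) := by
  have hr : rCoef p θ i i i = 0 := by
    rw [rCoef, ← h0]
    exact Finset.sum_congr rfl fun x _ => mul_div_cancel_left₀ _ (hpos i x).ne'
  have hl : lam p θ i i i = 1 := by
    rw [lam, ← h1]
    exact Finset.sum_congr rfl fun x _ => mul_div_cancel_left₀ _ (hpos i x).ne'
  rw [infoRep_eq_aux hpos hdiff, hr, hl, fisherInfo]
  simp [sq]

theorem sum_score_m (hpos : ∀ i x, 0 < p x (θ i))
    (hdiff : ∀ i x, DifferentiableAt ℝ (p x) (θ i)) {j : Fin n}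
    (h0 : ∑ x, deriv (p x) (θ j) = 0) (m : ℕ) : ∑ x, score_m p θ m j x = 0 := by
  have := iidSum_sum (fun a => p a (θ j)) m (fun a => deriv (p a) (θ j) / p a (θ j))
  rw [Finset.sum_congr rfl fun a _ => mul_div_cancel₀ (deriv (p a) (θ j)) (hpos j a).ne', h0,
    mul_zero] at this
  rw [← this]
  exact Finset.sum_congr rfl fun x _ => score_m_eq hpos hdiff m j x

/-- Centring is irrelevant for a test function of total sum zero. For local scores the bias vector
is thus the same at every `i`, so only the numbers `b j` matter asymptotically. -/
theorem biasVec_eq {Y : Type*} [Fintype Y] (P g : Fin n → Y → ℝ) (h : Y → ℝ) (i : Fin n) {j : Fin n}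
    (h0 : ∑ y, g j y = 0) : biasVec P g h i j = ∑ y, g j y * h y := by
  simp only [biasVec, mul_sub, Finset.sum_sub_distrib, ← Finset.sum_mul, h0, zero_mul, sub_zero]

end Scores

/-! ### Asymptotic orthogonality of scores at distinct distributions -/

section Overlap

variable {X : Type*} [Fintype X]

/-- The inner product with weight `1 / P`. -/
noncomputable def overlap (P f g : X → ℝ) : ℝ := ∑ x, f x * g x / P x

/-- The derivative of `∏ r, q (x r)` in the direction `u`, for a positive function `q`. -/
noncomputable def tensorScore (q u : X → ℝ) (m : ℕ) (x : Fin m → X) : ℝ :=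
  (∏ r, q (x r)) * ∑ r, u (x r) / q (x r)

/-- Linearity in the direction lets all scores at one and the same distribution be merged into a
single score. -/
theorem tensorScore_sum {X : Type*} (q : X → ℝ) {ι : Type*} (s : Finset ι) (a : ι → ℝ) (W : ι → X → ℝ) (m : ℕ)
    (x : Fin m → X) :
    tensorScore q (fun z => ∑ j ∈ s, a j * W j z) m x = ∑ j ∈ s, a j * tensorScore q (W j) m x := by
  simp only [tensorScore, Finset.sum_div, Finset.mul_sum]
  rw [Finset.sum_comm]
  exact Finset.sum_congr rfl fun j _ => Finset.sum_congr rfl fun r _ => by ring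

variable {P : X → ℝ}

theorem overlap_self_nonneg (hP : ∀ x, 0 < P x) (f : X → ℝ) : 0 ≤ overlap P f f :=
  Finset.sum_nonneg fun x _ => div_nonneg (mul_self_nonneg _) (hP x).le

theorem abs_overlap_le (hP : ∀ x, 0 < P x) (f g : X → ℝ) :
    |overlap P f g| ≤ √(overlap P f f) * √(overlap P g g) := by
  rw [← Real.sqrt_mul (overlap_self_nonneg hP f)]
  refine Real.abs_le_sqrt (Finset.sum_sq_le_sum_mul_sum_of_sq_le_mul _
    (fun x _ => div_nonneg (mul_self_nonneg _) (hP x).le)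
    (fun x _ => div_nonneg (mul_self_nonneg _) (hP x).le) fun x _ => le_of_eq ?_)
  ring

theorem overlap_self_pos (hP : ∀ x, 0 < P x) {f : X → ℝ} (hf : ∃ x, f x ≠ 0) :
    0 < overlap P f f := by
  obtain ⟨x, hx⟩ := hf
  exact Finset.sum_pos' (fun x _ => div_nonneg (mul_self_nonneg _) (hP x).le)
    ⟨x, Finset.mem_univ _, div_pos (mul_self_pos.2 hx) (hP x)⟩

theorem exists_ne_zero_of_sum_eq_one {q : X → ℝ} (hq : ∑ x, q x = 1) : ∃ x, q x ≠ 0 := by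
  by_contra! h
  simp [h] at hq

/-- Strict Cauchy–Schwarz: proportional functions of total sum one coincide, so the component `q - t
q'` of `q` orthogonal to `q'` has positive norm. -/
theorem overlap_lt_of_ne (hP : ∀ x, 0 < P x) {q q' : X → ℝ}
    (h1 : ∑ x, q x = 1) (h1' : ∑ x, q' x = 1) (hne : q ≠ q') :
    overlap P q q' < √(overlap P q q) * √(overlap P q' q') := by
  have hpos' := overlap_self_pos hP (exists_ne_zero_of_sum_eq_one h1')
  set t := overlap P q q' / overlap P q' q' with ht
  have hex : ∃ x, q x - t * q' x ≠ 0 := by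
    by_contra! h
    have hs : ∑ x, (q x - t * q' x) = 0 := Finset.sum_eq_zero fun x _ => h x
    rw [Finset.sum_sub_distrib, ← Finset.mul_sum, h1, h1'] at hs
    refine hne (funext fun x => ?_)
    have := h x
    rw [show t = 1 by linarith] at this
    linarith
  have hpos := overlap_self_pos hP (f := fun x => q x - t * q' x) hex
  have hexp : overlap P (fun x => q x - t * q' x) (fun x => q x - t * q' x) =
      overlap P q q - 2 * t * overlap P q q' + t ^ 2 * overlap P q' q' := by
    simp only [overlap, Finset.mul_sum, ← Finset.sum_sub_distrib, ← Finset.sum_add_distrib]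
    exact Finset.sum_congr rfl fun x _ => by ring
  have h2 : t * overlap P q' q' = overlap P q q' := by rw [ht]; field_simp
  rw [← Real.sqrt_mul (overlap_self_nonneg hP q)]
  refine Real.lt_sqrt_of_sq_lt ?_
  rw [hexp] at hpos
  have h3 : 0 < overlap P q q - t * overlap P q q' := by
    rw [sq, mul_assoc t t, h2] at hpos
    linarith
  have h4 := mul_pos h3 hpos'
  nlinarith

/-- The relative size of the overlap of two scores over `m` repetitions, when the cosine of the
angle between the two distributions is `ρ`. -/
noncomputable def crossCoef (ρ : ℝ) (m : ℕ) : ℝ := ((m : ℝ) - 1) * ρ ^ (m - 2) + ρ ^ (m - 1)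

theorem tendsto_crossCoef {ρ : ℝ} (h0 : 0 ≤ ρ) (h1 : ρ < 1) :
    Tendsto (crossCoef ρ) atTop (𝓝 0) := by
  rw [← tendsto_add_atTop_iff_nat 2]
  have hp := tendsto_pow_atTop_nhds_zero_of_lt_one h0 h1
  have hn := tendsto_self_mul_const_pow_of_lt_one h0 h1
  have := (hn.add hp).add (hp.mul_const ρ)
  simp only [zero_mul, add_zero] at this
  refine this.congr fun m => ?_
  simp only [crossCoef]
  rw [show m + 2 - 2 = m by omega, show m + 2 - 1 = m + 1 by omega, pow_succ]
  push_cast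
  ring

theorem sum_tensorScore_mul {q q' : X → ℝ} (hq : ∀ x, 0 < q x) (hq' : ∀ x, 0 < q' x)
    (u u' : X → ℝ) (m : ℕ) :
    ∑ x, tensorScore q u m x * tensorScore q' u' m x / ∏ r, P (x r) =
      (m : ℝ) * ((m : ℝ) - 1) * overlap P q q' ^ (m - 2) * (overlap P q' u * overlap P q u') +
        (m : ℝ) * overlap P q q' ^ (m - 1) * overlap P u u' :=
  sum_tensor_mul_tensor P hq hq' u u' m

/-- The cosine of the angle between `q` and `q'`. -/
noncomputable def overlapCos (P q q' : X → ℝ) : ℝ :=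
  overlap P q q' / (√(overlap P q q) * √(overlap P q' q'))

/-- The overlap of `q` and `q'` is `ρ` times their norms, and the other overlaps are bounded by
Cauchy–Schwarz. What remains is `crossCoef ρ m` times a product `x y`, and `x y ≤ x² + y²` splits it
into the two diagonal quantities. -/
theorem abs_sum_tensorScore_mul_le (hP : ∀ x, 0 < P x) {q q' : X → ℝ} (hq : ∀ x, 0 < q x)
    (hq' : ∀ x, 0 < q' x) (h1 : ∑ x, q x = 1) (h1' : ∑ x, q' x = 1) (u u' : X → ℝ) {m : ℕ}
    (hm : 2 ≤ m) :
    |∑ x, tensorScore q u m x * tensorScore q' u' m x / ∏ r, P (x r)| ≤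
      m * crossCoef (overlapCos P q q') m *
        (overlap P q q ^ (m - 1) * overlap P u u + overlap P q' q' ^ (m - 1) * overlap P u' u') := by
  have hΛ := overlap_self_pos hP (exists_ne_zero_of_sum_eq_one h1)
  have hΛ' := overlap_self_pos hP (exists_ne_zero_of_sum_eq_one h1')
  have hu := overlap_self_nonneg hP u
  have hu' := overlap_self_nonneg hP u'
  have c1 := abs_overlap_le hP q' u
  have c2 := abs_overlap_le hP q u'
  have c3 := abs_overlap_le hP u u'
  have hqq : 0 ≤ overlap P q q' :=
    Finset.sum_nonneg fun x _ => div_nonneg (mul_nonneg (hq x).le (hq' x).le) (hP x).le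
  rw [sum_tensorScore_mul hq hq']
  obtain ⟨k, rfl⟩ := Nat.exists_eq_add_of_le' hm
  rw [show k + 2 - 2 = k by omega, show k + 2 - 1 = k + 1 by omega]
  have hl : 0 < √(overlap P q q) := Real.sqrt_pos.2 hΛ
  have hl' : 0 < √(overlap P q' q') := Real.sqrt_pos.2 hΛ'
  have hν : 0 ≤ √(overlap P u u) := Real.sqrt_nonneg _
  have hν' : 0 ≤ √(overlap P u' u') := Real.sqrt_nonneg _
  rw [← Real.sq_sqrt hΛ.le, ← Real.sq_sqrt hΛ'.le, ← Real.sq_sqrt hu, ← Real.sq_sqrt hu']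
  have hρ : overlap P q q' = overlapCos P q q' * (√(overlap P q q) * √(overlap P q' q')) := by
    rw [overlapCos]; field_simp
  have hρ0 : 0 ≤ overlapCos P q q' := div_nonneg hqq (by positivity)
  rw [hρ]
  generalize √(overlap P q q) = l at *
  generalize √(overlap P q' q') = l' at *
  generalize √(overlap P u u) = ν at *
  generalize √(overlap P u' u') = ν' at *
  generalize overlapCos P q q' = ρ at *
  have b1 : |overlap P q' u * overlap P q u'| ≤ (l * l') * (ν * ν') := by
    rw [abs_mul]
    calc _ ≤ (l' * ν) * (l * ν') := mul_le_mul c1 c2 (abs_nonneg _) (by positivity)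
      _ = _ := by ring
  have hk : (0 : ℝ) ≤ k := k.cast_nonneg
  have hk2 : ((k + 2 : ℕ) : ℝ) = k + 2 := by push_cast; ring
  rw [hk2]
  have hcc : crossCoef ρ (k + 2) = (k + 1) * ρ ^ k + ρ ^ (k + 1) := by
    rw [crossCoef, show k + 2 - 2 = k by omega, show k + 2 - 1 = k + 1 by omega]
    push_cast; ring
  rw [hcc]
  calc _ ≤ (k + 2) * (k + 1) * (ρ * (l * l')) ^ k * ((l * l') * (ν * ν')) +
        (k + 2) * (ρ * (l * l')) ^ (k + 1) * (ν * ν') := by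
        refine (abs_add_le _ _).trans (add_le_add ?_ ?_)
        · rw [abs_mul, abs_of_nonneg (a := _ * _ * _)
            (mul_nonneg (mul_nonneg (by linarith) (by linarith)) (by positivity)),
            show (k : ℝ) + 2 - 1 = k + 1 by ring]
          exact mul_le_mul_of_nonneg_left b1 (by positivity)
        · rw [abs_mul, abs_of_nonneg (by positivity)]
          exact mul_le_mul_of_nonneg_left c3 (by positivity)
    _ = (k + 2) * ((k + 1) * ρ ^ k + ρ ^ (k + 1)) * ((l ^ (k + 1) * ν) * (l' ^ (k + 1) * ν')) := by
        ring
    _ ≤ _ := by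
        refine mul_le_mul_of_nonneg_left ?_ (by positivity)
        rw [← pow_mul, ← pow_mul, mul_comm 2 (k + 1), pow_mul, pow_mul, ← mul_pow, ← mul_pow]
        nlinarith [sq_nonneg (l ^ (k + 1) * ν - l' ^ (k + 1) * ν'),
          sq_nonneg (l ^ (k + 1) * ν), sq_nonneg (l' ^ (k + 1) * ν')]

/-- The total relative size of the off-diagonal overlaps of a finite set of distributions. -/
noncomputable def crossTotal (P : X → ℝ) (S : Finset (X → ℝ)) (m : ℕ) : ℝ :=
  ∑ z ∈ S ×ˢ S with z.1 ≠ z.2, crossCoef (overlapCos P z.1 z.2) m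

theorem tendsto_crossTotal (hP : ∀ x, 0 < P x) {S : Finset (X → ℝ)}
    (hS : ∀ q ∈ S, ∀ x, 0 < q x) (hS1 : ∀ q ∈ S, ∑ x, q x = 1) :
    Tendsto (crossTotal P S) atTop (𝓝 0) := by
  unfold crossTotal
  rw [← Finset.sum_const_zero (s := (S ×ˢ S).filter fun z => z.1 ≠ z.2)]
  refine tendsto_finsetSum _ fun z hz => ?_
  obtain ⟨hz, hne⟩ := Finset.mem_filter.1 hz
  obtain ⟨h1, h2⟩ := Finset.mem_product.1 hz
  have a1 := Real.sqrt_pos.2 (overlap_self_pos hP (exists_ne_zero_of_sum_eq_one (hS1 _ h1)))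
  have a2 := Real.sqrt_pos.2 (overlap_self_pos hP (exists_ne_zero_of_sum_eq_one (hS1 _ h2)))
  refine tendsto_crossCoef (div_nonneg (Finset.sum_nonneg fun x _ =>
    div_nonneg (mul_nonneg (hS _ h1 x).le (hS _ h2 x).le) (hP x).le) (by positivity)) ?_
  rw [overlapCos, div_lt_one (by positivity)]
  exact overlap_lt_of_ne hP (hS1 _ h1) (hS1 _ h2) hne

/-- Scores at distinct distributions are asymptotically orthogonal, hence a lower bound for the
norm of a combination of scores. -/
theorem tensorScore_gram_lower (hP : ∀ x, 0 < P x) {S : Finset (X → ℝ)}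
    (hS : ∀ q ∈ S, ∀ x, 0 < q x) (hS1 : ∀ q ∈ S, ∑ x, q x = 1) (u : (X → ℝ) → X → ℝ) {m : ℕ}
    (hm : 2 ≤ m) :
    m * (1 - crossTotal P S m) * ∑ q ∈ S, overlap P q q ^ (m - 1) * overlap P (u q) (u q) ≤
      ∑ x : Fin m → X, (∑ q ∈ S, tensorScore q (u q) m x) ^ 2 / ∏ r, P (x r) := by
  set N : (X → ℝ) → ℝ := fun q => overlap P q q ^ (m - 1) * overlap P (u q) (u q) with hN
  have hN0 : ∀ q, 0 ≤ N q := fun q =>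
    mul_nonneg (pow_nonneg (overlap_self_nonneg hP q) _) (overlap_self_nonneg hP _)
  set I : (X → ℝ) × (X → ℝ) → ℝ := fun z =>
    ∑ x, tensorScore z.1 (u z.1) m x * tensorScore z.2 (u z.2) m x / ∏ r, P (x r) with hI
  have hexp : ∑ x : Fin m → X, (∑ q ∈ S, tensorScore q (u q) m x) ^ 2 / ∏ r, P (x r) =
      ∑ z ∈ S ×ˢ S, I z := by
    simp only [hI]
    rw [Finset.sum_comm]
    refine Finset.sum_congr rfl fun x _ => ?_
    rw [sq, Finset.sum_mul_sum, ← Finset.sum_product', Finset.sum_div]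
  rw [hexp, ← Finset.sum_filter_add_sum_filter_not (S ×ˢ S) fun z => z.1 ≠ z.2]
  have hm1 : (0 : ℝ) ≤ m * ((m : ℝ) - 1) := by
    have : (2 : ℝ) ≤ m := by exact_mod_cast hm
    nlinarith
  -- For `q = q'` the `m (m - 1)` term contains a square and is nonnegative, so it can be dropped.
  have hdiag : m * ∑ q ∈ S, N q ≤ ∑ z ∈ S ×ˢ S with ¬ z.1 ≠ z.2, I z := by
    rw [Finset.mul_sum]
    have : ∑ z ∈ S ×ˢ S with ¬ z.1 ≠ z.2, I z = ∑ q ∈ S, I (q, q) := by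
      refine Finset.sum_bij' (fun z _ => z.1) (fun q _ => (q, q)) ?_ ?_ ?_ ?_ ?_ <;>
        simp +contextual [Prod.ext_iff]
    rw [this]
    refine Finset.sum_le_sum fun q hq => ?_
    simp only [hI, hN, sum_tensorScore_mul (hS q hq) (hS q hq)]
    have : 0 ≤ (m : ℝ) * ((m : ℝ) - 1) * overlap P q q ^ (m - 2) *
        (overlap P q (u q) * overlap P q (u q)) :=
      mul_nonneg (mul_nonneg hm1 (pow_nonneg (overlap_self_nonneg hP q) _)) (mul_self_nonneg _)
    linarith
  have hoff : -(m * crossTotal P S m * ∑ q ∈ S, N q) ≤ ∑ z ∈ S ×ˢ S with z.1 ≠ z.2, I z := by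
    rw [crossTotal, mul_right_comm, Finset.mul_sum, ← Finset.sum_neg_distrib]
    refine Finset.sum_le_sum fun z hz => ?_
    obtain ⟨hz, hne⟩ := Finset.mem_filter.1 hz
    obtain ⟨h1, h2⟩ := Finset.mem_product.1 hz
    have h := abs_sum_tensorScore_mul_le hP (hS _ h1) (hS _ h2) (hS1 _ h1) (hS1 _ h2)
      (u z.1) (u z.2) hm
    refine le_trans (neg_le_neg ?_) (neg_le_of_abs_le h)
    have hle : N z.1 + N z.2 ≤ ∑ q ∈ S, N q := by
      rw [← Finset.sum_pair hne]
      exact Finset.sum_le_sum_of_subset_of_nonneg (by simp [Finset.insert_subset_iff, h1, h2])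
        fun q _ _ => hN0 q
    rw [mul_right_comm _ (∑ q ∈ S, N q)]
    refine mul_le_mul_of_nonneg_left hle (mul_nonneg (Nat.cast_nonneg _) ?_)
    have : (2 : ℝ) ≤ m := by exact_mod_cast hm
    have hc : 0 ≤ overlapCos P z.1 z.2 := div_nonneg (Finset.sum_nonneg fun x _ =>
      div_nonneg (mul_nonneg (hS _ h1 x).le (hS _ h2 x).le) (hP x).le) (by positivity)
    exact add_nonneg (mul_nonneg (by linarith) (pow_nonneg hc _)) (pow_nonneg hc _)
  calc _ = -(m * crossTotal P S m * ∑ q ∈ S, N q) + m * ∑ q ∈ S, N q := by ring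
    _ ≤ _ := add_le_add hoff hdiag

end Overlap

/-! ### The fully global bound for a large number of repetitions -/

section Key

variable {X : Type*} [Fintype X] {n : ℕ}

/-- The score direction of the coefficients `a` at the distribution `q`: the part of the
combination `∑ j, a j * W j` with `Q j = q`. -/
noncomputable def groupScore (Q W : Fin n → X → ℝ) (a : Fin n → ℝ) (q : X → ℝ) (x : X) : ℝ :=
  ∑ j with Q j = q, a j * W j x

theorem sum_tensorScore_group (Q W : Fin n → X → ℝ) (a : Fin n → ℝ) (m : ℕ) (x : Fin m → X) :
    ∑ q ∈ Finset.univ.image Q, tensorScore q (groupScore Q W a q) m x =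
      ∑ j, a j * tensorScore (Q j) (W j) m x := by
  rw [← Finset.sum_fiberwise_of_maps_to (s := Finset.univ) (t := Finset.univ.image Q) (g := Q)
    (fun j _ => Finset.mem_image_of_mem Q (Finset.mem_univ j))]
  refine Finset.sum_congr rfl fun q _ => ?_
  refine (tensorScore_sum q _ a W m x).trans (Finset.sum_congr rfl fun j hj => ?_)
  rw [(Finset.mem_filter.1 hj).2]

theorem sum_group_eq (Q W : Fin n → X → ℝ) (a : Fin n → ℝ) (q : X → ℝ) {m : ℕ}
    (f : (Fin m → X) → ℝ) :
    ∑ j with Q j = q, a j * ∑ x, tensorScore (Q j) (W j) m x * f x =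
      ∑ x, tensorScore q (groupScore Q W a q) m x * f x := by
  simp only [Finset.mul_sum]
  rw [Finset.sum_comm]
  refine Finset.sum_congr rfl fun x _ => ?_
  have := tensorScore_sum q (Finset.univ.filter fun j => Q j = q) a W m x
  rw [show tensorScore q (groupScore Q W a q) m x = _ from this, Finset.sum_mul]
  refine Finset.sum_congr rfl fun j hj => ?_
  rw [(Finset.mem_filter.1 hj).2]
  ring

/-- A functional of the score direction at `q` is bounded by its values on the generators. -/
theorem exists_group_bound {P : X → ℝ} (hP : ∀ x, 0 < P x) (hP1 : ∀ x, P x ≤ 1)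
    (Q W : Fin n → X → ℝ) (q : X → ℝ) :
    ∃ M : ℝ, 0 ≤ M ∧ ∀ (m : ℕ) (f : (Fin m → X) → ℝ) (a b : Fin n → ℝ),
      (∀ j, b j = ∑ x, tensorScore (Q j) (W j) m x * f x) →
      (∑ j with Q j = q, a j * b j) ^ 2 ≤
        M * (∑ j, b j ^ 2) * overlap P (groupScore Q W a q) (groupScore Q W a q) := by
  -- `T` maps coefficients to the group score. The coefficients `a` themselves are not controlled by
  -- it, as the generators may be dependent; `T⁺` supplies coefficients `a'` with the same group
  -- score that are. The constant is the squared Frobenius norm of `T⁺`, independent of `m` and `f`.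
  set T : Matrix X (Fin n) ℝ := Matrix.of fun x j => if Q j = q then W j x else 0 with hT
  have hTa : ∀ a, T *ᵥ a = groupScore Q W a q := by
    intro a
    ext x
    simp only [hT, Matrix.mulVec, dotProduct, groupScore, Matrix.of_apply, Finset.sum_filter,
      ite_mul, zero_mul]
    exact Finset.sum_congr rfl fun j _ => by rw [mul_comm]
  refine ⟨∑ j, ∑ x, pinv T j x ^ 2, by positivity, fun m f a b hb => ?_⟩
  set u := groupScore Q W a q with hu
  set a' : Fin n → ℝ := pinv T *ᵥ u with ha'
  have hu' : groupScore Q W a' q = u := by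
    rw [← hTa, ha', hu, ← hTa, Matrix.mulVec_mulVec, Matrix.mulVec_mulVec,
      (pinv_spec T).mul_mul_self]
  -- The functional sees the coefficients only through the group score.
  have h1 : ∑ j with Q j = q, a j * b j = ∑ j with Q j = q, a' j * b j := by
    simp only [hb]
    rw [sum_group_eq, sum_group_eq, hu']
  have h2 : (∑ j with Q j = q, a' j * b j) ^ 2 ≤ (∑ j, a' j ^ 2) * ∑ j, b j ^ 2 := by
    refine (Finset.sum_mul_sq_le_sq_mul_sq _ _ _).trans ?_
    refine mul_le_mul ?_ ?_ (by positivity) (by positivity) <;>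
      exact Finset.sum_le_sum_of_subset_of_nonneg (Finset.filter_subset _ _)
        fun j _ _ => sq_nonneg _
  have h3 : ∑ j, a' j ^ 2 ≤ (∑ j, ∑ x, pinv T j x ^ 2) * ∑ x, u x ^ 2 := by
    rw [Finset.sum_mul]
    exact Finset.sum_le_sum fun j _ => Finset.sum_mul_sq_le_sq_mul_sq _ _ _
  have h4 : ∑ x, u x ^ 2 ≤ overlap P u u := by
    refine Finset.sum_le_sum fun x _ => ?_
    rw [← sq]
    exact le_div_self (sq_nonneg _) (hP x) (hP1 x)
  rw [h1]
  calc _ ≤ _ := h2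
    _ ≤ ((∑ j, ∑ x, pinv T j x ^ 2) * overlap P u u) * ∑ j, b j ^ 2 :=
        mul_le_mul_of_nonneg_right (h3.trans (mul_le_mul_of_nonneg_left h4 (by positivity)))
          (by positivity)
    _ = _ := by ring

theorem overlap_self_of_sum_eq_one {P : X → ℝ} (hP : ∀ x, 0 < P x) (h1 : ∑ x, P x = 1) :
    overlap P P P = 1 := by
  rw [← h1]
  exact Finset.sum_congr rfl fun x _ => mul_div_cancel_left₀ _ (hP x).ne'

/-- The quotients `(aᵀ b)² / (aᵀ C a)` are asymptotically bounded by the local quotient at the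
distribution `Q i`, up to a relative error that tends to zero. -/
theorem exists_score_quotient_bound {Q : Fin n → X → ℝ} (W : Fin n → X → ℝ)
    (hQ : ∀ j x, 0 < Q j x) (hQ1 : ∀ j, ∑ x, Q j x = 1) (i : Fin n)
    (hown : ∀ j, Q j = Q i → ∃ r : ℝ, ∀ x, W j x = r * W i x) :
    ∃ ε : ℕ → ℝ, Tendsto ε atTop (𝓝 0) ∧ ∀ᶠ m : ℕ in atTop, 0 ≤ ε m ∧
      ∀ (f : (Fin m → X) → ℝ) (a b : Fin n → ℝ),
        (∀ j, b j = ∑ x, tensorScore (Q j) (W j) m x * f x) →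
        (∑ j, a j * b j) ^ 2 ≤
          (∑ x, (∑ j, a j * tensorScore (Q j) (W j) m x) ^ 2 / ∏ r, Q i (x r)) *
            ((b i ^ 2 / overlap (Q i) (W i) (W i) + ε m * ∑ j, b j ^ 2) / m) := by
  classical
  set P := Q i with hPdef
  have hP : ∀ x, 0 < P x := hQ i
  have hP1 : ∀ x, P x ≤ 1 := fun x => by
    rw [← hQ1 i]
    exact Finset.single_le_sum (f := Q i) (fun y _ => (hQ i y).le) (Finset.mem_univ x)
  set S := Finset.univ.image Q with hS
  have hSpos : ∀ q ∈ S, ∀ x, 0 < q x := by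
    intro q hq; obtain ⟨j, -, rfl⟩ := Finset.mem_image.1 hq; exact hQ j
  have hS1 : ∀ q ∈ S, ∑ x, q x = 1 := by
    intro q hq; obtain ⟨j, -, rfl⟩ := Finset.mem_image.1 hq; exact hQ1 j
  have hPS : P ∈ S := Finset.mem_image_of_mem Q (Finset.mem_univ i)
  choose M hM0 hM using exists_group_bound hP hP1 Q W
  set F := overlap P (W i) (W i) with hF
  have hF0 : 0 ≤ F := overlap_self_nonneg hP _
  set e : ℕ → ℝ := crossTotal P S with he
  have he0 : Tendsto e atTop (𝓝 0) := tendsto_crossTotal hP hSpos hS1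
  -- Contribution of the other distributions, damped exponentially because their overlap with
  -- themselves exceeds one.
  set δ : ℕ → ℝ := fun m => ∑ q ∈ S.erase P, M q / overlap P q q ^ (m - 1) with hδ
  have hΛ : ∀ q ∈ S.erase P, 1 < overlap P q q := by
    intro q hq
    obtain ⟨hne, hq⟩ := Finset.mem_erase.1 hq
    obtain ⟨h1, h2⟩ := chiSq_overlap P q (fun x => (hP x).le) (fun x => (hSpos q hq x).le)
      (hQ1 i) (hS1 q hq) fun x _ => hP x
    have : overlap P q q = ∑ x, q x ^ 2 / P x := by simp only [overlap, sq]
    rw [this]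
    exact lt_of_le_of_ne h1 fun h => hne (h2.1 h.symm)
  have hδ0 : Tendsto δ atTop (𝓝 0) := by
    rw [hδ, ← Finset.sum_const_zero (s := S.erase P)]
    refine tendsto_finsetSum _ fun q hq => ?_
    refine Tendsto.div_atTop tendsto_const_nhds ?_
    exact (tendsto_pow_atTop_atTop_of_one_lt (hΛ q hq)).comp (tendsto_sub_atTop_nat 1)
  have hδn : ∀ m, 0 ≤ δ m := fun m => Finset.sum_nonneg fun q hq =>
    div_nonneg (hM0 q) (pow_nonneg (zero_le_one.trans (hΛ q hq).le) _)
  -- The summand with `F⁻¹` pays for removing the factor `1 / (1 - e m)` from `b i ^ 2 / F`, by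
  -- means of `b i ^ 2 ≤ ∑ j, b j ^ 2`.
  refine ⟨fun m => (δ m + |e m| * F⁻¹) / (1 - e m), ?_, ?_⟩
  · have h1 : Tendsto (fun m => 1 - e m) atTop (𝓝 (1 - 0)) := tendsto_const_nhds.sub he0
    have := (hδ0.add (he0.abs.mul_const F⁻¹)).div h1 (by norm_num)
    simpa [Pi.div_def] using this
  filter_upwards [he0.eventually_lt_const (u := 1) one_pos, eventually_ge_atTop 2] with m hem hm2
  have hm0 : (0 : ℝ) < m := by exact_mod_cast (by omega : 0 < m)
  have he1 : 0 < 1 - e m := by linarith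
  refine ⟨div_nonneg (add_nonneg (hδn m) (mul_nonneg (abs_nonneg _) (inv_nonneg.2 hF0))) he1.le, ?_⟩
  intro f a b hb
  set β := ∑ j, b j ^ 2 with hβ
  have hβ0 : 0 ≤ β := by positivity
  have hbi : b i ^ 2 ≤ β :=
    Finset.single_le_sum (f := fun j => b j ^ 2) (fun j _ => sq_nonneg _) (Finset.mem_univ i)
  set u := groupScore Q W a with hu
  set N := ∑ q ∈ S, overlap P q q ^ (m - 1) * overlap P (u q) (u q) with hN
  have hlow := tensorScore_gram_lower hP hSpos hS1 u hm2
  have hsum : ∀ x : Fin m → X, ∑ q ∈ S, tensorScore q (u q) m x =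
      ∑ j, a j * tensorScore (Q j) (W j) m x := sum_tensorScore_group Q W a m
  simp only [hsum] at hlow
  set C := ∑ x, (∑ j, a j * tensorScore (Q j) (W j) m x) ^ 2 / ∏ r, P (x r) with hC
  -- All directions at `P` are multiples of `W i`, so the local quotient is exact and no constant is
  -- lost. If `F = 0`, then `W i = 0` and `b i = 0`.
  have hownb : (∑ j with Q j = P, a j * b j) ^ 2 ≤ b i ^ 2 / F * overlap P (u P) (u P) := by
    choose! r hr using hown
    set s := ∑ j with Q j = P, a j * r j with hs
    have hu1 : u P = fun x => s * W i x := by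
      ext x
      rw [hu, groupScore, hs, Finset.sum_mul]
      refine Finset.sum_congr rfl fun j hj => ?_
      rw [hr j (Finset.mem_filter.1 hj).2, mul_assoc]
    have hb1 : ∀ j, Q j = P → b j = r j * b i := by
      intro j hj
      rw [hb, hb i, Finset.mul_sum]
      refine Finset.sum_congr rfl fun x _ => ?_
      simp only [tensorScore, hj, hr j hj, ← hPdef, mul_div_assoc, ← Finset.mul_sum]
      ring
    have hs1 : ∑ j with Q j = P, a j * b j = s * b i := by
      rw [hs, Finset.sum_mul]
      refine Finset.sum_congr rfl fun j hj => ?_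
      rw [hb1 j (Finset.mem_filter.1 hj).2, mul_assoc]
    have hs2 : overlap P (u P) (u P) = s ^ 2 * F := by
      rw [hu1, hF, overlap, overlap, Finset.mul_sum]
      exact Finset.sum_congr rfl fun x _ => by ring
    rw [hs1, hs2]
    by_cases hFz : F = 0
    · have hWi : ∀ x, W i x = 0 := by
        intro x
        by_contra hx
        exact (overlap_self_pos hP ⟨x, hx⟩).ne' hFz
      have : b i = 0 := by rw [hb]; simp [tensorScore, hWi]
      simp [this]
    · refine le_of_eq ?_
      field_simp
  set κ : (X → ℝ) → ℝ := fun q => if q = P then b i ^ 2 / F else M q * β with hκ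
  have hκ0 : ∀ q, 0 ≤ κ q := by
    intro q
    simp only [hκ]
    split_ifs
    · exact div_nonneg (sq_nonneg _) hF0
    · exact mul_nonneg (hM0 q) hβ0
  have hκb : ∀ q, (∑ j with Q j = q, a j * b j) ^ 2 ≤ κ q * overlap P (u q) (u q) := by
    intro q
    simp only [hκ]
    split_ifs with hq
    · rw [hq]; exact hownb
    · exact hM q m f a b hb
  have hΛpos : ∀ q ∈ S, 0 < overlap P q q := fun q hq =>
    overlap_self_pos hP (exists_ne_zero_of_sum_eq_one (hS1 q hq))
  -- Cauchy–Schwarz over the groups, weighted by `overlap P q q ^ (m - 1)` so that the second factor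
  -- is the quantity `N` of the Gram lower bound.
  have hCS : (∑ j, a j * b j) ^ 2 ≤ (∑ q ∈ S, κ q / overlap P q q ^ (m - 1)) * N := by
    rw [← Finset.sum_fiberwise_of_maps_to (s := Finset.univ) (t := S) (g := Q)
      (fun j _ => Finset.mem_image_of_mem Q (Finset.mem_univ j))]
    refine Finset.sum_sq_le_sum_mul_sum_of_sq_le_mul _
      (fun q hq => div_nonneg (hκ0 q) (pow_pos (hΛpos q hq) _).le)
      (fun q hq => mul_nonneg (pow_pos (hΛpos q hq) _).le (overlap_self_nonneg hP _))
      fun q hq => ?_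
    have h1 := hκb q
    have h2 := (pow_pos (hΛpos q hq) (m - 1)).ne'
    calc _ ≤ _ := h1
      _ = _ := by field_simp
  have hκsum : ∑ q ∈ S, κ q / overlap P q q ^ (m - 1) = b i ^ 2 / F + δ m * β := by
    rw [← Finset.add_sum_erase _ _ hPS, overlap_self_of_sum_eq_one hP (hQ1 i), one_pow, div_one]
    congr 1
    · simp [hκ]
    · rw [hδ, Finset.sum_mul]
      refine Finset.sum_congr rfl fun q hq => ?_
      simp only [hκ, if_neg (Finset.ne_of_mem_erase hq)]
      ring
  rw [hκsum] at hCS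
  have hC0 : 0 ≤ C := Finset.sum_nonneg fun x _ =>
    div_nonneg (sq_nonneg _) (Finset.prod_pos fun r _ => hP _).le
  have hNle : N ≤ C / (m * (1 - e m)) := by
    rw [le_div_iff₀ (by positivity)]
    linarith
  have hL0 : 0 ≤ b i ^ 2 / F + δ m * β :=
    add_nonneg (div_nonneg (sq_nonneg _) hF0) (mul_nonneg (hδn m) hβ0)
  calc _ ≤ _ := hCS
    _ ≤ (b i ^ 2 / F + δ m * β) * (C / (m * (1 - e m))) := mul_le_mul_of_nonneg_left hNle hL0
    _ = C * (((b i ^ 2 / F + δ m * β) / (1 - e m)) / m) := by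
        field_simp
    _ ≤ _ := by
        refine mul_le_mul_of_nonneg_left (div_le_div_of_nonneg_right ?_ hm0.le) hC0
        rw [div_le_iff₀ he1, add_mul, mul_right_comm, div_mul_cancel₀ _ he1.ne']
        have h1 : b i ^ 2 / F * e m ≤ |e m| * F⁻¹ * β := by
          rw [div_eq_mul_inv]
          calc b i ^ 2 * F⁻¹ * e m ≤ b i ^ 2 * F⁻¹ * |e m| :=
                mul_le_mul_of_nonneg_left (le_abs_self _) (by positivity)
            _ ≤ β * F⁻¹ * |e m| := by gcongr
            _ = _ := by ring
        nlinarith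

/-- If the distribution `Q i` occurs only once, then its score is not asymptotically cancelled by
the other scores. -/
theorem eventually_score_lower {Q : Fin n → X → ℝ} (W : Fin n → X → ℝ)
    (hQ : ∀ j x, 0 < Q j x) (hQ1 : ∀ j, ∑ x, Q j x = 1) (i : Fin n)
    (hown : ∀ j, j ≠ i → Q j ≠ Q i) :
    ∀ᶠ m : ℕ in atTop, ∀ a : Fin n → ℝ,
      m / 2 * (a i ^ 2 * overlap (Q i) (W i) (W i)) ≤
        ∑ x : Fin m → X, (∑ j, a j * tensorScore (Q j) (W j) m x) ^ 2 / ∏ r, Q i (x r) := by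
  set P := Q i with hPdef
  have hP : ∀ x, 0 < P x := hQ i
  set S := Finset.univ.image Q with hS
  have hSpos : ∀ q ∈ S, ∀ x, 0 < q x := by
    intro q hq; obtain ⟨j, -, rfl⟩ := Finset.mem_image.1 hq; exact hQ j
  have hS1 : ∀ q ∈ S, ∑ x, q x = 1 := by
    intro q hq; obtain ⟨j, -, rfl⟩ := Finset.mem_image.1 hq; exact hQ1 j
  have hPS : P ∈ S := Finset.mem_image_of_mem Q (Finset.mem_univ i)
  filter_upwards [(tendsto_crossTotal hP hSpos hS1).eventually_lt_const (u := 1 / 2) (by norm_num),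
    eventually_ge_atTop 2] with m hem hm2 a
  have hlow := tensorScore_gram_lower hP hSpos hS1 (groupScore Q W a) hm2
  simp only [hS, sum_tensorScore_group Q W a m] at hlow
  refine le_trans ?_ hlow
  have hu : groupScore Q W a P = fun x => a i * W i x := by
    ext x
    rw [groupScore, Finset.sum_eq_single_of_mem i (by simp [hPdef])]
    intro j hj hji
    exact absurd (Finset.mem_filter.1 hj).2 (hown j hji)
  have hterm : overlap P P P ^ (m - 1) * overlap P (groupScore Q W a P) (groupScore Q W a P) =
      a i ^ 2 * overlap P (W i) (W i) := by
    rw [overlap_self_of_sum_eq_one hP (hQ1 i), one_pow, one_mul, hu]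
    simp only [overlap, Finset.mul_sum]
    exact Finset.sum_congr rfl fun x _ => by ring
  have hle : a i ^ 2 * overlap P (W i) (W i) ≤
      ∑ q ∈ S, overlap P q q ^ (m - 1) * overlap P (groupScore Q W a q) (groupScore Q W a q) := by
    rw [← hterm]
    exact Finset.single_le_sum (f := fun q => overlap P q q ^ (m - 1) *
      overlap P (groupScore Q W a q) (groupScore Q W a q)) (fun q _ =>
        mul_nonneg (pow_nonneg (overlap_self_nonneg hP q) _) (overlap_self_nonneg hP _)) hPS
  have hm : (0 : ℝ) ≤ m := m.cast_nonneg
  refine mul_le_mul ?_ hle (mul_nonneg (sq_nonneg _) (overlap_self_nonneg hP _)) ?_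
  · rw [div_eq_mul_one_div]
    exact mul_le_mul_of_nonneg_left (by linarith) hm
  · exact mul_nonneg hm (by linarith)

end Key

/-! ### Asymptotics of the information matrix of the repeated model -/

section Model

variable {X : Type*} {n : ℕ} {p : X → ℝ → ℝ} {θ : Fin n → ℝ}

theorem score_m_eq_tensorScore (hpos : ∀ i x, 0 < p x (θ i))
    (hdiff : ∀ i x, DifferentiableAt ℝ (p x) (θ i)) (m : ℕ) (j : Fin n) :
    score_m p θ m j = tensorScore (fun x => p x (θ j)) (fun x => deriv (p x) (θ j)) m :=
  funext fun x => score_m_eq hpos hdiff m j x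

variable [Fintype X]

theorem overlap_deriv_self (i : Fin n) :
    overlap (fun x => p x (θ i)) (fun x => deriv (p x) (θ i)) (fun x => deriv (p x) (θ i)) =
      fisherInfo p (θ i) := by
  simp [overlap, fisherInfo, sq]

theorem fisherInfo_nonneg (hpos : ∀ i x, 0 < p x (θ i)) (i : Fin n) : 0 ≤ fisherInfo p (θ i) :=
  Finset.sum_nonneg fun x _ => div_nonneg (sq_nonneg _) (hpos i x).le

/-- For a large number of repetitions `bᵀ C⁺ b` is bounded by the local term, up to a small
multiple of `∑ j, b j ^ 2`. -/
theorem exists_pinv_infoRep_bound (hpos : ∀ i x, 0 < p x (θ i))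
    (hdiff : ∀ i x, DifferentiableAt ℝ (p x) (θ i)) (hsum : ∀ i, ∑ x, p x (θ i) = 1) (i : Fin n)
    (hown : ∀ j, (∀ x, p x (θ j) = p x (θ i)) →
      ∃ r : ℝ, ∀ x, deriv (p x) (θ j) = r * deriv (p x) (θ i)) :
    ∃ ε : ℕ → ℝ, Tendsto ε atTop (𝓝 0) ∧ ∀ᶠ m : ℕ in atTop,
      ∀ (f : (Fin m → X) → ℝ) (b : Fin n → ℝ), (∀ j, b j = ∑ x, score_m p θ m j x * f x) →
        b ⬝ᵥ (pinv (infoRep p θ i m) *ᵥ b) ≤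
          (b i ^ 2 / fisherInfo p (θ i) + ε m * ∑ j, b j ^ 2) / m := by
  obtain ⟨ε, hε, h⟩ := exists_score_quotient_bound (Q := fun j x => p x (θ j))
    (fun j x => deriv (p x) (θ j)) hpos hsum i fun j hj => hown j fun x => congrFun hj x
  refine ⟨ε, hε, ?_⟩
  filter_upwards [h] with m hm f b hb
  have hP := dist_m_pos hpos m
  refine pinv_infoMatrix_le _ (hP i) (div_nonneg (add_nonneg
    (div_nonneg (sq_nonneg _) (fisherInfo_nonneg hpos i))
    (mul_nonneg hm.1 (Finset.sum_nonneg fun j _ => sq_nonneg _))) m.cast_nonneg) fun a => ?_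
  have h2 := hm.2 f a b fun j => by rw [hb, score_m_eq_tensorScore hpos hdiff]
  rw [overlap_deriv_self] at h2
  rw [quadForm_infoMatrix]
  simp only [score_m_eq_tensorScore hpos hdiff]
  exact h2

/-- `C` may be singular and `z` outside its range, so `z` is replaced by its projection `b = C C⁺
z`, which has the same value of the form and no larger norm. The upper bound is the asymptotic
quotient bound; the lower one tests `b` against the `i`-th basis vector. -/
theorem tendsto_quadForm_pinv_infoRep (hpos : ∀ i x, 0 < p x (θ i))
    (hdiff : ∀ i x, DifferentiableAt ℝ (p x) (θ i)) (hsum : ∀ i, ∑ x, p x (θ i) = 1)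
    (hderiv : ∀ i, ∑ x, deriv (p x) (θ i) = 0) (i : Fin n)
    (hne : ∀ j, j ≠ i → ∃ x, p x (θ j) ≠ p x (θ i)) (z : Fin n → ℝ) :
    Tendsto (fun m : ℕ => (m : ℝ) * (z ⬝ᵥ (pinv (infoRep p θ i m) *ᵥ z))) atTop
      (𝓝 (z i ^ 2 / fisherInfo p (θ i))) := by
  obtain ⟨ε, hε, hbound⟩ := exists_pinv_infoRep_bound hpos hdiff hsum i fun j hj => by
    by_cases hji : j = i
    · exact ⟨1, fun x => by rw [hji, one_mul]⟩
    · obtain ⟨x, hx⟩ := hne j hji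
      exact absurd (hj x) hx
  have hlow := eventually_score_lower (Q := fun j x => p x (θ j))
    (fun j x => deriv (p x) (θ j)) hpos hsum i fun j hj h => by
      obtain ⟨x, hx⟩ := hne j hj
      exact hx (congrFun h x)
  set F := fisherInfo p (θ i) with hF
  have hF0 : 0 ≤ F := fisherInfo_nonneg hpos i
  have hup : Tendsto (fun m => z i ^ 2 / F + |ε m| * ∑ j, z j ^ 2) atTop (𝓝 (z i ^ 2 / F)) := by
    have := (hε.abs.mul_const (∑ j, z j ^ 2)).const_add (z i ^ 2 / F)
    simpa using this
  have key : ∀ᶠ m : ℕ in atTop, z i ^ 2 / F ≤ (m : ℝ) * (z ⬝ᵥ (pinv (infoRep p θ i m) *ᵥ z)) ∧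
      (m : ℝ) * (z ⬝ᵥ (pinv (infoRep p θ i m) *ᵥ z)) ≤ z i ^ 2 / F + |ε m| * ∑ j, z j ^ 2 := by
    filter_upwards [hbound, hlow, eventually_gt_atTop 0] with m hb hl hm
    have hm0 : (0 : ℝ) < m := by exact_mod_cast hm
    have hP := dist_m_pos hpos m i
    set C := infoRep p θ i m with hC
    have hCs : C.IsSymm := infoMatrix_isSymm _ _ i
    set d := pinv C *ᵥ z with hd
    set b := C *ᵥ d with hbdef
    set e := z - b with he
    have hCe : C *ᵥ e = 0 := mulVec_residual hCs z
    have hval : b ⬝ᵥ (pinv C *ᵥ b) = z ⬝ᵥ d := by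
      have h1 : pinv C *ᵥ b = d := by
        rw [hbdef, hd, Matrix.mulVec_mulVec, Matrix.mulVec_mulVec, (pinv_spec C).self_mul_mul]
      rw [h1, hbdef, dotProduct_comm, hd, quadForm_pinv_mulVec hCs]
    -- Being of the form `C d`, the vector `b` pairs the scores with one function of the data, as
    -- both bounds require.
    have hbf : ∀ j, b j = ∑ x, score_m p θ m j x *
        ((∑ k, d k * score_m p θ m k x) / dist_m p θ m i x) := by
      intro j
      have := dotProduct_infoMatrix (dist_m p θ m) (score_m p θ m) i (Pi.single j 1) d
      rw [single_one_dotProduct] at this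
      rw [hbdef, hC, infoRep, this]
      refine Finset.sum_congr rfl fun x _ => ?_
      simp [Pi.single_apply, mul_div_assoc]
    have heb : e ⬝ᵥ b = 0 := by
      rw [hbdef, dotProduct_mulVec_symm hCs, hCe, zero_dotProduct]
    have hnorm : ∑ j, b j ^ 2 ≤ ∑ j, z j ^ 2 := by
      have h1 : ∀ j, z j ^ 2 = b j ^ 2 + 2 * (e j * b j) + e j ^ 2 := fun j => by
        rw [he, Pi.sub_apply]; ring
      have h2 : ∑ j, e j * b j = 0 := heb
      rw [Finset.sum_congr rfl fun j _ => h1 j, Finset.sum_add_distrib, Finset.sum_add_distrib,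
        ← Finset.mul_sum, h2]
      have : 0 ≤ ∑ j, e j ^ 2 := by positivity
      linarith
    -- A kernel vector has vanishing `i`-th coordinate if `F > 0`, by the lower bound for
    -- combinations of scores. For `F = 0` both quotients are `0` by convention.
    have hbi : b i ^ 2 / F = z i ^ 2 / F := by
      rcases hF0.eq_or_lt with h0 | h0
      · simp [← h0]
      · have h1 := hl e
        have h2 : e ⬝ᵥ (C *ᵥ e) = 0 := by rw [hCe, dotProduct_zero]
        rw [hC, infoRep, quadForm_infoMatrix] at h2
        simp only [score_m_eq_tensorScore hpos hdiff] at h2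
        have h3 : (m : ℝ) / 2 * (e i ^ 2 * F) ≤ 0 := by
          rw [overlap_deriv_self] at h1
          exact h1.trans h2.le
        have h4 : e i ^ 2 ≤ 0 := by
          by_contra! hlt
          have : 0 < (m : ℝ) / 2 * (e i ^ 2 * F) := by positivity
          linarith
        have h5 : e i = 0 := pow_eq_zero_iff two_ne_zero |>.1 (le_antisymm h4 (sq_nonneg _))
        rw [he, Pi.sub_apply, sub_eq_zero] at h5
        rw [h5]
    have hle := hb _ b hbf
    rw [hval, hbi] at hle
    have hge := sq_dotProduct_le_pinv (score_m p θ m) hP _ hbf (Pi.single i 1)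
    have hCii : infoMatrix (dist_m p θ m) (score_m p θ m) i i i = m * F :=
      infoRep_diag hpos hdiff (hsum i) (hderiv i) m
    have hval' : b ⬝ᵥ (pinv (infoMatrix (dist_m p θ m) (score_m p θ m) i) *ᵥ b) = z ⬝ᵥ d := hval
    rw [hval', single_one_dotProduct, single_one_dotProduct, Matrix.mulVec_single_one,
      Matrix.col_apply, hCii] at hge
    constructor
    · rcases hF0.eq_or_lt with h0 | h0
      · rw [← h0, div_zero, ← hval']
        exact mul_nonneg hm0.le (pinv_infoMatrix_nonneg _ hP b)
      · rw [← hbi, div_le_iff₀ h0]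
        calc _ ≤ _ := hge
          _ = _ := by ring
    · rw [le_div_iff₀ hm0, mul_comm] at hle
      refine hle.trans (add_le_add le_rfl ?_)
      exact (mul_le_mul_of_nonneg_right (le_abs_self _) (by positivity)).trans
        (mul_le_mul_of_nonneg_left hnorm (abs_nonneg _))
  exact tendsto_of_tendsto_of_tendsto_of_le_of_le' tendsto_const_nhds hup
    (key.mono fun m h => h.1) (key.mono fun m h => h.2)

/-- Polarization: the limits of the quadratic form at `e_j + e_k`, `e_j` and `e_k` determine the
entry `(j, k)`, by symmetry. -/
theorem tendsto_pinv_infoRep (hpos : ∀ i x, 0 < p x (θ i))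
    (hdiff : ∀ i x, DifferentiableAt ℝ (p x) (θ i)) (hsum : ∀ i, ∑ x, p x (θ i) = 1)
    (hderiv : ∀ i, ∑ x, deriv (p x) (θ i) = 0) (i : Fin n)
    (hne : ∀ j, j ≠ i → ∃ x, p x (θ j) ≠ p x (θ i)) :
    Tendsto (fun m : ℕ => pinv ((m : ℝ)⁻¹ • infoRep p θ i m)) atTop
      (𝓝 (Matrix.single i i (1 / infoRep p θ i 1 i i))) := by
  have hF : infoRep p θ i 1 i i = fisherInfo p (θ i) := by
    rw [infoRep_diag hpos hdiff (hsum i) (hderiv i)]; simp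
  rw [hF]
  refine tendsto_pi_nhds.2 fun j => tendsto_pi_nhds.2 fun k => ?_
  have hq := tendsto_quadForm_pinv_infoRep hpos hdiff hsum hderiv i hne
  have h := (((hq (Pi.single j 1 + Pi.single k 1)).sub (hq (Pi.single j 1))).sub
    (hq (Pi.single k 1))).div_const 2
  refine Tendsto.congr' ?_ (h.trans_eq ?_)
  · filter_upwards [eventually_gt_atTop 0] with m hm
    have hm0 : (m : ℝ) ≠ 0 := by exact_mod_cast hm.ne'
    have hs := (pinv_isSymm (infoMatrix_isSymm (dist_m p θ m) (score_m p θ m) i)).apply j k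
    rw [pinv_smul _ (inv_ne_zero hm0), inv_inv]
    simp only [Matrix.mulVec_add, add_dotProduct, dotProduct_add, single_one_dotProduct,
      Matrix.mulVec_single_one, Matrix.col_apply, Matrix.smul_apply, smul_eq_mul, infoRep] at hs ⊢
    rw [hs]
    ring
  · congr 1
    simp only [Pi.add_apply, Pi.single_apply, Matrix.single_apply]
    rcases eq_or_ne j i with rfl | hj <;> rcases eq_or_ne k j with rfl | hk
    · simp; ring
    · simp [hk.symm]
    · simp [hj.symm]
    · rcases eq_or_ne k i with rfl | hk' <;> simp [*, Ne.symm]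

/-! ### Comparison of the two bounds -/

theorem biasRep_eq (hpos : ∀ i x, 0 < p x (θ i))
    (hdiff : ∀ i x, DifferentiableAt ℝ (p x) (θ i))
    (hderiv : ∀ i, ∑ x, deriv (p x) (θ i) = 0)
    (est : EstimatorSeq X) (i j : Fin n) (m : ℕ) :
    biasRep p θ est i j m = ∑ x, score_m p θ m j x * est m x :=
  biasVec_eq _ _ _ i (sum_score_m hpos hdiff (hderiv j) m)

theorem gcrRep_eq (hpos : ∀ i x, 0 < p x (θ i))
    (hdiff : ∀ i x, DifferentiableAt ℝ (p x) (θ i)) (hsum : ∀ i, ∑ x, p x (θ i) = 1)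
    (hderiv : ∀ i, ∑ x, deriv (p x) (θ i) = 0)
    (w : Fin n → ℝ) (est : EstimatorSeq X) (m : ℕ) :
    gcrRep w p θ est m =
      ∑ i, w i * (biasRep p θ est i i m ^ 2 / (m * fisherInfo p (θ i))) := by
  simp only [← infoRep_diag hpos hdiff (hsum _) (hderiv _)]
  rfl

/-- The local terms `b i ^ 2 / F_i`, weighted, sum to `m` times the global Cramér–Rao bound, so only
the error terms survive in the difference. -/
theorem exists_fgRep_sub_gcrRep_le (hpos : ∀ i x, 0 < p x (θ i))
    (hdiff : ∀ i x, DifferentiableAt ℝ (p x) (θ i)) (hsum : ∀ i, ∑ x, p x (θ i) = 1)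
    (hderiv : ∀ i, ∑ x, deriv (p x) (θ i) = 0)
    {w : Fin n → ℝ} (hw : ∀ i, 0 ≤ w i)
    (hown : ∀ i j, (∀ x, p x (θ j) = p x (θ i)) →
      ∃ r : ℝ, ∀ x, deriv (p x) (θ j) = r * deriv (p x) (θ i)) (est : EstimatorSeq X) :
    ∃ ε : ℕ → ℝ, Tendsto ε atTop (𝓝 0) ∧ ∀ᶠ m : ℕ in atTop,
      (m : ℝ) * (fgRep w p θ est m - gcrRep w p θ est m) ≤
        ε m * ∑ j, biasRep p θ est j j m ^ 2 := by
  choose ε hε hb using fun i => exists_pinv_infoRep_bound hpos hdiff hsum i (hown i)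
  refine ⟨fun m => ∑ i, w i * ε i m, ?_, ?_⟩
  · have := tendsto_finsetSum Finset.univ fun i _ => (hε i).const_mul (w i)
    simpa using this
  · filter_upwards [eventually_all.2 hb, eventually_gt_atTop 0] with m hm hm0
    have hm0 : (0 : ℝ) < m := by exact_mod_cast hm0
    rw [gcrRep_eq hpos hdiff hsum hderiv, fgRep, fullyGlobalBound, ← Finset.sum_sub_distrib,
      Finset.mul_sum, Finset.sum_mul]
    refine Finset.sum_le_sum fun i _ => ?_
    have hbb : ∀ j, biasRep p θ est j j m =
        biasVec (dist_m p θ m) (score_m p θ m) (est m) i j := fun j => by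
      rw [biasRep_eq hpos hdiff hderiv]
      exact (biasRep_eq hpos hdiff hderiv est i j m).symm
    have h := hm i (est m) (biasVec (dist_m p θ m) (score_m p θ m) (est m) i)
      fun j => biasRep_eq hpos hdiff hderiv est i j m
    simp only [← hbb] at h
    rw [le_div_iff₀ hm0] at h
    have h2 := mul_le_mul_of_nonneg_left h (hw i)
    unfold infoRep at h2
    have h3 : w i * (biasRep p θ est i i m ^ 2 / (m * fisherInfo p (θ i))) * m =
        w i * (biasRep p θ est i i m ^ 2 / fisherInfo p (θ i)) := by
      rw [mul_assoc, div_mul_eq_mul_div, mul_comm (_ ^ 2), mul_div_mul_left _ _ hm0.ne']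
    nlinarith

theorem tendsto_fgRep_sub_gcrRep (hpos : ∀ i x, 0 < p x (θ i))
    (hdiff : ∀ i x, DifferentiableAt ℝ (p x) (θ i)) (hsum : ∀ i, ∑ x, p x (θ i) = 1)
    (hderiv : ∀ i, ∑ x, deriv (p x) (θ i) = 0)
    {w : Fin n → ℝ} (hw : ∀ i, 0 ≤ w i)
    (hown : ∀ i j, (∀ x, p x (θ j) = p x (θ i)) →
      ∃ r : ℝ, ∀ x, deriv (p x) (θ j) = r * deriv (p x) (θ i)) (est : EstimatorSeq X)
    (hb : ∀ j, biasRep p θ est j j =O[atTop] fun _ => (1 : ℝ)) :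
    Tendsto (fun m : ℕ => (m : ℝ) * (fgRep w p θ est m - gcrRep w p θ est m)) atTop (𝓝 0) := by
  obtain ⟨ε, hε, hle⟩ := exists_fgRep_sub_gcrRep_le hpos hdiff hsum hderiv hw hown est
  have hβ : (fun m => ∑ j, biasRep p θ est j j m ^ 2) =O[atTop] fun _ => (1 : ℝ) :=
    IsBigO.fun_sum fun j _ => by simpa using (hb j).pow 2
  have hlim : Tendsto (fun m => ε m * ∑ j, biasRep p θ est j j m ^ 2) atTop (𝓝 0) := by
    refine (isLittleO_one_iff ℝ).1 ?_
    simpa using ((isLittleO_one_iff ℝ).2 hε).mul_isBigO hβ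
  refine tendsto_of_tendsto_of_tendsto_of_le_of_le' tendsto_const_nhds hlim
    (Eventually.of_forall fun m => mul_nonneg m.cast_nonneg (sub_nonneg.2 ?_)) hle
  exact globalCRBound_le_fullyGlobalBound _ _ hw (dist_m_pos hpos m)

/-- The error `o(1) ∑ b_j²` is compared with `m` times the global Cramér–Rao bound in two steps:
positive weights, or the hypothesis for zero weights, give `∑ b_j² = O(∑ w_i b_i²)`, and each `w_i
b_i²` is at most `F_i m` times that bound. When `F_i = 0` the score vanishes, so `b_i = 0`. -/
theorem fgRep_isEquivalent_gcrRep (hpos : ∀ i x, 0 < p x (θ i))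
    (hdiff : ∀ i x, DifferentiableAt ℝ (p x) (θ i)) (hsum : ∀ i, ∑ x, p x (θ i) = 1)
    (hderiv : ∀ i, ∑ x, deriv (p x) (θ i) = 0)
    {w : Fin n → ℝ} (hw : ∀ i, 0 ≤ w i)
    (hown : ∀ i j, (∀ x, p x (θ j) = p x (θ i)) →
      ∃ r : ℝ, ∀ x, deriv (p x) (θ j) = r * deriv (p x) (θ i)) (est : EstimatorSeq X)
    (hb : ∀ j, w j = 0 → (fun m => biasRep p θ est j j m ^ 2) =O[atTop]
      fun m => ∑ i, w i * biasRep p θ est i i m ^ 2) :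
    fgRep w p θ est ~[atTop] gcrRep w p θ est := by
  obtain ⟨ε, hε, hle⟩ := exists_fgRep_sub_gcrRep_le hpos hdiff hsum hderiv hw hown est
  have hw0 : ∀ m (i : Fin n), 0 ≤ w i * biasRep p θ est i i m ^ 2 := fun m i =>
    mul_nonneg (hw i) (sq_nonneg _)
  have hβ : (fun m => ∑ j, biasRep p θ est j j m ^ 2) =O[atTop]
      fun m => ∑ i, w i * biasRep p θ est i i m ^ 2 := by
    refine IsBigO.fun_sum fun j _ => ?_
    rcases (hw j).eq_or_lt with h0 | h0
    · exact hb j h0.symm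
    · refine isBigO_of_le' (c := (w j)⁻¹) _ fun m => ?_
      rw [Real.norm_of_nonneg (sq_nonneg _),
        Real.norm_of_nonneg (Finset.sum_nonneg fun i _ => hw0 m i), le_inv_mul_iff₀ h0]
      exact Finset.single_le_sum (f := fun i => w i * biasRep p θ est i i m ^ 2)
        (fun i _ => hw0 m i) (Finset.mem_univ j)
  have hgcr : (fun m => ∑ i, w i * biasRep p θ est i i m ^ 2) =O[atTop]
      fun m : ℕ => (m : ℝ) * gcrRep w p θ est m := by
    refine IsBigO.fun_sum fun i _ => ?_
    refine IsBigO.of_bound (fisherInfo p (θ i)) ?_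
    filter_upwards [eventually_gt_atTop 0] with m hm
    have hm0 : (0 : ℝ) < m := by exact_mod_cast hm
    have hg0 : ∀ i, 0 ≤ w i * (biasRep p θ est i i m ^ 2 / (m * fisherInfo p (θ i))) := fun i =>
      mul_nonneg (hw i) (div_nonneg (sq_nonneg _)
        (mul_nonneg hm0.le (fisherInfo_nonneg hpos i)))
    have hF0 := fisherInfo_nonneg hpos i
    have hsingle := Finset.single_le_sum (s := Finset.univ) (fun i _ => hg0 i) (Finset.mem_univ i)
    rw [Real.norm_of_nonneg (hw0 m i), gcrRep_eq hpos hdiff hsum hderiv,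
      Real.norm_of_nonneg (mul_nonneg hm0.le (Finset.sum_nonneg fun i _ => hg0 i))]
    rcases hF0.eq_or_lt with h0 | h0
    · have hz : biasRep p θ est i i m = 0 := by
        have hd : ∀ x, deriv (p x) (θ i) = 0 := by
          intro x
          have := (Finset.sum_eq_zero_iff_of_nonneg fun x _ =>
            div_nonneg (sq_nonneg _) (hpos i x).le).1 h0.symm x (Finset.mem_univ x)
          rw [div_eq_zero_iff, or_iff_left (hpos i x).ne'] at this
          exact pow_eq_zero_iff two_ne_zero |>.1 this
        rw [biasRep_eq hpos hdiff hderiv]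
        refine Finset.sum_eq_zero fun x _ => ?_
        rw [score_m_eq hpos hdiff]
        simp [hd]
      rw [hz, ← h0]; simp
    · refine le_trans (le_of_eq ?_) (mul_le_mul_of_nonneg_left
        (mul_le_mul_of_nonneg_left hsingle hm0.le) hF0)
      field_simp
  have hlit : (fun m => ε m * ∑ j, biasRep p θ est j j m ^ 2) =o[atTop]
      fun m : ℕ => (m : ℝ) * gcrRep w p θ est m := by
    simpa using ((isLittleO_one_iff ℝ).2 hε).mul_isBigO (hβ.trans hgcr)
  have hdiff' : (fun m : ℕ => (m : ℝ) * (fgRep w p θ est m - gcrRep w p θ est m)) =O[atTop]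
      fun m => ε m * ∑ j, biasRep p θ est j j m ^ 2 := by
    refine IsBigO.of_bound 1 ?_
    filter_upwards [hle] with m hm
    have h0 : 0 ≤ (m : ℝ) * (fgRep w p θ est m - gcrRep w p θ est m) :=
      mul_nonneg m.cast_nonneg (sub_nonneg.2
        (globalCRBound_le_fullyGlobalBound _ _ hw (dist_m_pos hpos m)))
    rw [Real.norm_of_nonneg h0, one_mul, Real.norm_of_nonneg (h0.trans hm)]
    exact hm
  refine IsLittleO.of_bound fun c hc => ?_
  filter_upwards [(hdiff'.trans_isLittleO hlit).bound hc, eventually_gt_atTop 0] with m hm hm0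
  have hm0 : (0 : ℝ) < ‖(m : ℝ)‖ := by simpa using hm0
  rw [norm_mul, norm_mul] at hm
  refine le_of_mul_le_mul_left ?_ hm0
  calc _ ≤ _ := hm
    _ = _ := by ring

end Model

/-! ### Deviations of the empirical distribution -/

section Empirical

variable {X : Type*} [Fintype X]

open Classical in
/-- The deviation of the empirical frequency of `z` in the data `x` from `P z`. -/
noncomputable def empDev (P : X → ℝ) (m : ℕ) (x : Fin m → X) (z : X) : ℝ :=
  (∑ r, ((if x r = z then 1 else 0) - P z)) / m

theorem sum_eq_empDev (P : X → ℝ) {m : ℕ} (hm : 0 < m) (x : Fin m → X) (f : X → ℝ) :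
    ∑ r, f (x r) = m * ∑ z, (P z + empDev P m x z) * f z := by
  classical
  have hm0 : (m : ℝ) ≠ 0 := by exact_mod_cast hm.ne'
  have h1 : ∀ z, m * (P z + empDev P m x z) = ∑ r, if x r = z then 1 else 0 := by
    intro z
    rw [empDev, mul_add, mul_div_cancel₀ _ hm0, Finset.sum_sub_distrib]
    simp only [Finset.sum_const, Finset.card_univ, Fintype.card_fin, nsmul_eq_mul,
      add_sub_cancel]
  rw [Finset.mul_sum]
  simp only [← mul_assoc, h1, Finset.sum_mul, ite_mul, one_mul, zero_mul]
  rw [Finset.sum_comm]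
  simp

variable {P : X → ℝ}

theorem abs_indicator_sub_le (hP : ∀ x, 0 ≤ P x) (hP1 : ∑ x, P x = 1) (z : X) (c : Prop)
    [Decidable c] : |(if c then (1 : ℝ) else 0) - P z| ≤ 1 := by
  have h1 : P z ≤ 1 := by
    rw [← hP1]; exact Finset.single_le_sum (fun y _ => hP y) (Finset.mem_univ z)
  rw [abs_le]
  split_ifs <;> constructor <;> linarith [hP z]

theorem abs_empDev_le (hP : ∀ x, 0 ≤ P x) (hP1 : ∑ x, P x = 1) (m : ℕ) (x : Fin m → X) (z : X) :
    |empDev P m x z| ≤ 1 := by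
  classical
  rw [empDev, abs_div, Nat.abs_cast]
  refine div_le_one_of_le₀ ((Finset.abs_sum_le_sum_abs _ _).trans ?_) m.cast_nonneg
  refine (Finset.sum_le_card_nsmul _ _ 1 fun r _ => abs_indicator_sub_le hP hP1 z _).trans ?_
  simp

theorem sum_indicator_sub [DecidableEq X] (hP1 : ∑ x, P x = 1) (z : X) :
    ∑ a, P a * ((if a = z then 1 else 0) - P z) = 0 := by
  simp [mul_sub, ← Finset.sum_mul, hP1]

theorem iidSum_empDev_sq_le (hP : ∀ x, 0 ≤ P x) (hP1 : ∑ x, P x = 1) (m : ℕ) (z : X) :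
    m * iidSum P m (fun x => empDev P m x z ^ 2) ≤ 1 := by
  classical
  rcases Nat.eq_zero_or_pos m with rfl | hm
  · simp
  have hm0 : (0 : ℝ) < m := by exact_mod_cast hm
  have h := iidSum_sq_of_centered hP1 (sum_indicator_sub hP1 z) m
  have h2 : ∑ a, P a * ((if a = z then 1 else 0) - P z) ^ 2 ≤ 1 := by
    refine le_of_le_of_eq (Finset.sum_le_sum fun a _ => mul_le_of_le_one_right (hP a) ?_) hP1
    rw [← sq_abs]
    exact pow_le_one₀ (abs_nonneg _) (abs_indicator_sub_le hP hP1 z _)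
  have h3 : ∀ x : Fin m → X, empDev P m x z ^ 2 =
      ((m : ℝ) ^ 2)⁻¹ * (∑ r, ((if x r = z then 1 else 0) - P z)) ^ 2 := by
    intro x
    rw [empDev, div_pow, div_eq_inv_mul]
  simp only [h3, iidSum_const_mul, h]
  calc _ = ∑ a, P a * ((if a = z then 1 else 0) - P z) ^ 2 := by field_simp
    _ ≤ 1 := h2

/-- Needed because `m` times the probability of a large deviation must tend to zero; second moments
would only show that it is bounded. -/
theorem iidSum_empDev_pow_four_le (hP : ∀ x, 0 ≤ P x) (hP1 : ∑ x, P x = 1) {m : ℕ} (hm : 0 < m)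
    (z : X) : m * iidSum P m (fun x => empDev P m x z ^ 4) ≤ 3 / m := by
  classical
  have hm0 : (0 : ℝ) < m := by exact_mod_cast hm
  have h := iidSum_pow_four_le hP hP1 (sum_indicator_sub hP1 z)
    (fun a => abs_indicator_sub_le hP hP1 z _) m
  have h3 : ∀ x : Fin m → X, empDev P m x z ^ 4 =
      ((m : ℝ) ^ 4)⁻¹ * (∑ r, ((if x r = z then 1 else 0) - P z)) ^ 4 := by
    intro x
    rw [empDev, div_pow, div_eq_inv_mul]
  simp only [h3, iidSum_const_mul]
  calc _ ≤ (m : ℝ) * (((m : ℝ) ^ 4)⁻¹ * (3 * (m : ℝ) ^ 2)) := by gcongr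
    _ = _ := by field_simp

/-- A bounded quantity that is small compared with the deviations of the empirical distribution,
whenever these are small, has second moment `o(1 / m)`. -/
theorem tendsto_mul_iidSum_sq (hP : ∀ x, 0 ≤ P x) (hP1 : ∑ x, P x = 1)
    (e : (m : ℕ) → (Fin m → X) → ℝ) {D : ℝ} (hD : ∀ m x, |e m x| ≤ D)
    (he : ∀ ε > 0, ∃ η > 0, ∀ m > 0, ∀ x : Fin m → X, (∀ z, |empDev P m x z| ≤ η) →
      e m x ^ 2 ≤ ε * ∑ z, empDev P m x z ^ 2) :
    Tendsto (fun m : ℕ => (m : ℝ) * iidSum P m (fun x => e m x ^ 2)) atTop (𝓝 0) := by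
  have hnn : ∀ m : ℕ, 0 ≤ (m : ℝ) * iidSum P m (fun x => e m x ^ 2) := fun m =>
    mul_nonneg m.cast_nonneg (Finset.sum_nonneg fun x _ =>
      mul_nonneg (Finset.prod_nonneg fun r _ => hP _) (sq_nonneg _))
  rw [Metric.tendsto_atTop']
  intro ε hε
  set c : ℝ := (Fintype.card X : ℝ) with hc
  have hc0 : 0 ≤ c := Nat.cast_nonneg _
  -- The second moments, times `m`, total at most `c`, so this choice costs at most `ε / 2`; the `+
  -- 1` keeps the denominator positive.
  obtain ⟨η, hη, h⟩ := he (ε / (2 * (c + 1))) (by positivity)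
  set M := D ^ 2 / η ^ 4 with hM
  have hM0 : 0 ≤ M := by positivity
  have hlim : Tendsto (fun m : ℕ => M * (c * (3 / (m : ℝ)))) atTop (𝓝 0) := by
    have := ((tendsto_const_div_atTop_nhds_zero_nat (3 : ℝ)).const_mul c).const_mul M
    simpa using this
  obtain ⟨N, hN⟩ := eventually_atTop.1 (hlim.eventually_lt_const (u := ε / 2) (by positivity))
  refine ⟨N, fun m hm => ?_⟩
  have hm0 : 0 < m := by omega
  rw [Real.dist_0_eq_abs, abs_of_nonneg (hnn m)]
  -- Where some deviation exceeds `η`, the crude bound `D ^ 2` is absorbed by the fourth powers,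
  -- since one of them is at least `η ^ 4`.
  have hpt : ∀ x : Fin m → X, e m x ^ 2 ≤
      ε / (2 * (c + 1)) * ∑ z, empDev P m x z ^ 2 + M * ∑ z, empDev P m x z ^ 4 := by
    intro x
    by_cases hg : ∀ z, |empDev P m x z| ≤ η
    · have : 0 ≤ M * ∑ z, empDev P m x z ^ 4 :=
        mul_nonneg hM0 (Finset.sum_nonneg fun z _ => by positivity)
      linarith [h m hm0 x hg]
    · push Not at hg
      obtain ⟨z, hz⟩ := hg
      have h1 : η ^ 4 ≤ ∑ z, empDev P m x z ^ 4 := by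
        refine le_trans ?_ (Finset.single_le_sum (f := fun z => empDev P m x z ^ 4)
          (fun z _ => by positivity) (Finset.mem_univ z))
        have : empDev P m x z ^ 4 = |empDev P m x z| ^ 4 := by
          rw [pow_abs, abs_of_nonneg (by positivity)]
        rw [this]
        gcongr
      have h2 : e m x ^ 2 ≤ D ^ 2 := by
        rw [← sq_abs]
        exact pow_le_pow_left₀ (abs_nonneg _) (hD m x) 2
      have h3 : D ^ 2 ≤ M * ∑ z, empDev P m x z ^ 4 := by
        calc D ^ 2 = M * η ^ 4 := by rw [hM]; field_simp
          _ ≤ _ := mul_le_mul_of_nonneg_left h1 hM0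
      have h4 : 0 ≤ ε / (2 * (c + 1)) * ∑ z, empDev P m x z ^ 2 := by positivity
      linarith
  have hI := iidSum_mono hP hpt
  rw [iidSum_add, iidSum_const_mul, iidSum_const_mul, iidSum_finsetSum, iidSum_finsetSum] at hI
  have hI2 : (m : ℝ) * ∑ z, iidSum P m (fun x => empDev P m x z ^ 2) ≤ c := by
    rw [Finset.mul_sum]
    refine (Finset.sum_le_card_nsmul _ _ 1 fun z _ => iidSum_empDev_sq_le hP hP1 m z).trans ?_
    simp [hc]
  have hI4 : (m : ℝ) * ∑ z, iidSum P m (fun x => empDev P m x z ^ 4) ≤ c * (3 / m) := by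
    rw [Finset.mul_sum]
    refine (Finset.sum_le_card_nsmul _ _ _
      fun z _ => iidSum_empDev_pow_four_le hP hP1 hm0 z).trans ?_
    simp [hc]
  have hN' := hN m hm.le
  have hfrac : ε / (2 * (c + 1)) * c ≤ ε / 2 := by
    rw [div_mul_eq_mul_div, div_le_div_iff₀ (by positivity) (by positivity)]
    nlinarith
  calc (m : ℝ) * iidSum P m (fun x => e m x ^ 2)
      ≤ m * (ε / (2 * (c + 1)) * ∑ z, iidSum P m (fun x => empDev P m x z ^ 2) +
          M * ∑ z, iidSum P m (fun x => empDev P m x z ^ 4)) :=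
        mul_le_mul_of_nonneg_left hI m.cast_nonneg
    _ = ε / (2 * (c + 1)) * (m * ∑ z, iidSum P m (fun x => empDev P m x z ^ 2)) +
          M * (m * ∑ z, iidSum P m (fun x => empDev P m x z ^ 4)) := by ring
    _ ≤ ε / (2 * (c + 1)) * c + M * (c * (3 / m)) := by gcongr
    _ < ε := by linarith

/-! ### Variance of a perturbed centered quantity -/

theorem iidSum_variance (hP1 : ∑ x, P x = 1) {m : ℕ} {Z : (Fin m → X) → ℝ}
    (hZ : iidSum P m Z = 0) (c : ℝ) (e : (Fin m → X) → ℝ) :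
    iidSum P m (fun x => (c + Z x + e x - iidSum P m fun x => c + Z x + e x) ^ 2) =
      iidSum P m (fun x => Z x ^ 2) + 2 * iidSum P m (fun x => Z x * e x) +
        iidSum P m (fun x => e x ^ 2) - iidSum P m e ^ 2 := by
  have hmean : iidSum P m (fun x => c + Z x + e x) = c + iidSum P m e := by
    rw [iidSum_add, iidSum_add, iidSum_const, hP1, hZ]; simp
  rw [hmean]
  set E := iidSum P m e with hE
  have hexp : ∀ x, (c + Z x + e x - (c + E)) ^ 2 =
      Z x ^ 2 + 2 * (Z x * e x) + e x ^ 2 + (-(2 * E)) * Z x + (-(2 * E)) * e x + E ^ 2 := by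
    intro x; ring
  simp only [hexp, iidSum_add, iidSum_const_mul, iidSum_const, hP1, hZ, one_pow]
  ring

theorem sq_iidSum_mul_le (hP : ∀ x, 0 ≤ P x) {m : ℕ} (Z e : (Fin m → X) → ℝ) :
    iidSum P m (fun x => Z x * e x) ^ 2 ≤
      iidSum P m (fun x => Z x ^ 2) * iidSum P m (fun x => e x ^ 2) := by
  have h0 : ∀ x : Fin m → X, 0 ≤ ∏ r, P (x r) := fun x => Finset.prod_nonneg fun r _ => hP _
  refine Finset.sum_sq_le_sum_mul_sum_of_sq_le_mul _ (fun x _ => mul_nonneg (h0 x) (sq_nonneg _))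
    (fun x _ => mul_nonneg (h0 x) (sq_nonneg _)) fun x _ => le_of_eq ?_
  ring

theorem sq_iidSum_le (hP : ∀ x, 0 ≤ P x) (hP1 : ∑ x, P x = 1) {m : ℕ} (e : (Fin m → X) → ℝ) :
    iidSum P m e ^ 2 ≤ iidSum P m (fun x => e x ^ 2) := by
  have := sq_iidSum_mul_le hP (fun _ => 1) e
  simpa [iidSum_const, hP1] using this

end Empirical

/-! ### Consistency of likelihood maximizers -/

section Likelihood

variable {X : Type*} [Fintype X] {p : X → ℝ → ℝ}

/-- `2 - 2 ∑ √Q √P` equals `∑ (√Q - √P)²`, the squared Hellinger distance up to normalization. -/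
theorem sum_sqrt_mul_lt_one {P Q : X → ℝ} (hP : ∀ x, 0 ≤ P x) (hQ : ∀ x, 0 ≤ Q x)
    (hP1 : ∑ x, P x = 1) (hQ1 : ∑ x, Q x = 1) (hne : ∃ x, Q x ≠ P x) :
    ∑ x, √(Q x) * √(P x) < 1 := by
  obtain ⟨y, hy⟩ := hne
  have h1 : 0 < ∑ x, (√(Q x) - √(P x)) ^ 2 := by
    refine Finset.sum_pos' (fun x _ => sq_nonneg _) ⟨y, Finset.mem_univ _, ?_⟩
    refine sq_pos_of_ne_zero (sub_ne_zero.2 fun h => hy ?_)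
    exact (Real.sqrt_inj (hQ y) (hP y)).1 h
  have h2 : ∀ x, (√(Q x) - √(P x)) ^ 2 = Q x + P x - 2 * (√(Q x) * √(P x)) := by
    intro x
    nlinarith [Real.sq_sqrt (hQ x), Real.sq_sqrt (hP x)]
  simp only [h2, Finset.sum_sub_distrib, Finset.sum_add_distrib, ← Finset.mul_sum, hP1, hQ1] at h1
  linarith

/-- If the empirical distribution is close to `p(·|θ₀)`, then the likelihood at `θ₀` exceeds the
likelihood on a compact set of parameters with other distributions. -/
theorem exists_likelihood_lt {S : Set ℝ} (hS : IsCompact S) (hcont : ∀ x, ContinuousOn (p x) S)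
    (hnn : ∀ t ∈ S, ∀ x, 0 ≤ p x t) (hsum : ∀ t ∈ S, ∑ x, p x t = 1) {θ₀ : ℝ}
    (hpos : ∀ x, 0 < p x θ₀) (hsum₀ : ∑ x, p x θ₀ = 1) (hne : ∀ t ∈ S, ∃ x, p x t ≠ p x θ₀) :
    ∃ η > 0, ∀ m > 0, ∀ x : Fin m → X, (∀ z, |empDev (fun a => p a θ₀) m x z| ≤ η) →
      ∀ t ∈ S, jointProb p m x t < jointProb p m x θ₀ := by
  -- Compactness makes the gap uniform: the continuous affinity attains its maximum, which is below
  -- one.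
  obtain ⟨κ, hκ1, hκ⟩ : ∃ κ < 1, ∀ t ∈ S, ∑ x, √(p x t) * √(p x θ₀) ≤ κ := by
    rcases S.eq_empty_or_nonempty with rfl | hSne
    · exact ⟨0, one_pos, by simp⟩
    · have hc : ContinuousOn (fun t => ∑ x, √(p x t) * √(p x θ₀)) S :=
        continuousOn_finsetSum _ fun x _ =>
          (Real.continuous_sqrt.comp_continuousOn (hcont x)).mul continuousOn_const
      obtain ⟨t₀, ht₀, hmax⟩ := hS.exists_isMaxOn hSne hc
      exact ⟨_, sum_sqrt_mul_lt_one (fun x => (hpos x).le) (hnn t₀ ht₀) hsum₀ (hsum t₀ ht₀)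
        (hne t₀ ht₀), fun t ht => hmax ht⟩
  -- As `p x t ≤ 1`, the sum of the root ratios `f` is at most `A` for every `t`; with `η (A + 1) =
  -- (1 - κ) / 2` the empirical mean of `f` stays below one.
  set A := ∑ x, (√(p x θ₀))⁻¹ with hA
  have hA0 : 0 ≤ A := Finset.sum_nonneg fun x _ => inv_nonneg.2 (Real.sqrt_nonneg _)
  refine ⟨(1 - κ) / (2 * (A + 1)), div_pos (by linarith) (by linarith), fun m hm x hx t ht => ?_⟩
  set η := (1 - κ) / (2 * (A + 1)) with hη
  have hη0 : 0 < η := div_pos (by linarith) (by linarith)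
  have hm0 : (0 : ℝ) < m := by exact_mod_cast hm
  -- Square roots of likelihood ratios instead of logarithms, since `p z t` may vanish. Their mean
  -- under `p(·|θ₀)` is the affinity.
  set f : X → ℝ := fun z => √(p z t) / √(p z θ₀) with hf
  have hs0 : ∀ z, 0 < √(p z θ₀) := fun z => Real.sqrt_pos.2 (hpos z)
  have hf0 : ∀ z, 0 ≤ f z := fun z => div_nonneg (Real.sqrt_nonneg _) (hs0 z).le
  have hfle : ∀ z, f z ≤ (√(p z θ₀))⁻¹ := by
    intro z
    rw [hf]
    simp only
    rw [div_eq_mul_inv]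
    refine mul_le_of_le_one_left (inv_nonneg.2 (hs0 z).le) (Real.sqrt_le_one.2 ?_)
    rw [← hsum t ht]
    exact Finset.single_le_sum (fun y _ => hnn t ht y) (Finset.mem_univ z)
  have havg : ∑ z, (p z θ₀ + empDev (fun a => p a θ₀) m x z) * f z < 1 := by
    have h1 : ∀ z, (p z θ₀ + empDev (fun a => p a θ₀) m x z) * f z ≤
        √(p z t) * √(p z θ₀) + η * (√(p z θ₀))⁻¹ := by
      intro z
      rw [add_mul]
      refine add_le_add (le_of_eq ?_) ?_
      · have h2 := Real.mul_self_sqrt (hpos z).le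
        have h3 := (hs0 z).ne'
        rw [hf]
        simp only
        rw [mul_div_assoc', div_eq_iff h3]
        linear_combination (-√(p z t)) * h2
      · exact mul_le_mul ((le_abs_self _).trans (hx z)) (hfle z) (hf0 z) hη0.le
    refine lt_of_le_of_lt (Finset.sum_le_sum fun z _ => h1 z) ?_
    rw [Finset.sum_add_distrib, ← Finset.mul_sum, ← hA]
    have h2 : η * (A + 1) = (1 - κ) / 2 := by rw [hη]; field_simp
    nlinarith [hκ t ht]
  -- `f ≤ exp (f - 1)` turns an empirical mean below one into a product below one.
  have hprod : ∏ r, f (x r) < 1 := by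
    calc ∏ r, f (x r) ≤ ∏ r, Real.exp (f (x r) - 1) :=
          Finset.prod_le_prod (fun r _ => hf0 _) fun r _ => by
            linarith [Real.add_one_le_exp (f (x r) - 1)]
      _ = Real.exp (∑ r, (f (x r) - 1)) := (Real.exp_sum _ _).symm
      _ < 1 := by
          rw [Real.exp_lt_one_iff, Finset.sum_sub_distrib,
            sum_eq_empDev (fun a => p a θ₀) hm x f]
          simp only [Finset.sum_const, Finset.card_univ, Fintype.card_fin, nsmul_eq_mul, mul_one]
          nlinarith
  have hprod0 : 0 ≤ ∏ r, f (x r) := Finset.prod_nonneg fun r _ => hf0 _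
  have hj0 : 0 < jointProb p m x θ₀ := Finset.prod_pos fun r _ => hpos (x r)
  have hj : jointProb p m x t = (∏ r, f (x r)) ^ 2 * jointProb p m x θ₀ := by
    rw [jointProb, jointProb, ← Finset.prod_pow, ← Finset.prod_mul_distrib]
    refine Finset.prod_congr rfl fun r _ => ?_
    have h2 := (hpos (x r)).ne'
    rw [hf]
    simp only
    rw [div_pow, Real.sq_sqrt (hnn t ht _), Real.sq_sqrt (hpos _).le, div_mul_cancel₀ _ h2]
  rw [hj]
  exact mul_lt_of_lt_one_left hj0 (pow_lt_one₀ hprod0 hprod two_ne_zero)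

end Likelihood

/-! ### Asymptotics of maximum-likelihood estimators -/

section MLE

variable {X : Type*} [Fintype X] {p : X → ℝ → ℝ}

theorem sum_mul_deriv_div {t : ℝ} (hpos : ∀ x, 0 < p x t) (h0 : ∑ x, deriv (p x) t = 0) :
    ∑ x, p x t * (deriv (p x) t / p x t) = 0 := by
  rw [← h0]
  exact Finset.sum_congr rfl fun x _ => mul_div_cancel₀ _ (hpos x).ne'

/-- Stochastic expansion of the maximum-likelihood estimator: it agrees with the linear functional
of the empirical distribution given by the normalized score, up to a relatively small error. -/
theorem exists_mle_expansion {K : Set ℝ} (hK : IsCompact K) (hnn : ∀ t ∈ K, ∀ x, 0 ≤ p x t)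
    (hsum : ∀ t ∈ K, ∑ x, p x t = 1) (hcont : ∀ x, ContinuousOn (p x) K) {θ₀ : ℝ}
    (hθ : θ₀ ∈ interior K) (hpos : ∀ x, 0 < p x θ₀) (hC1 : ∀ x, ContDiffAt ℝ 1 (p x) θ₀)
    (hne : ∀ t ∈ K, t ≠ θ₀ → ∃ x, p x t ≠ p x θ₀) (hF : 0 < fisherInfo p θ₀)
    {est : EstimatorSeq X} (hest : IsMLE p K est) {ε : ℝ} (hε : 0 < ε) :
    ∃ η > 0, ∀ m > 0, ∀ x : Fin m → X, (∀ z, |empDev (fun a => p a θ₀) m x z| ≤ η) →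
      |est m x - θ₀ - (∑ z, empDev (fun a => p a θ₀) m x z * (deriv (p z) θ₀ / p z θ₀)) /
        fisherInfo p θ₀| ≤ ε * ∑ z, |empDev (fun a => p a θ₀) m x z| := by
  set F := fisherInfo p θ₀ with hFdef
  set ψ : ℝ → X → ℝ := fun t z => deriv (p z) t / p z t with hψ
  -- The difference quotient `dslope`, equal to the derivative at `θ₀`, replaces a Taylor expansion
  -- of the score: `G` is continuous at `θ₀` with value `F`, and one continuous derivative suffices.
  set G : ℝ → ℝ := fun t => ∑ z, dslope (p z) θ₀ t * ψ t z with hG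
  have hd : ∀ x, DifferentiableAt ℝ (p x) θ₀ := fun x => (hC1 x).differentiableAt one_ne_zero
  have hderivc : ∀ x, ContinuousAt (deriv (p x)) θ₀ := by
    intro x
    have h := ((hC1 x).continuousAt_fderiv one_ne_zero).clm_apply
      (continuousAt_const (y := (1 : ℝ)))
    simpa only [fderiv_apply_one_eq_deriv] using h
  have hψc : ∀ z, ContinuousAt (fun t => ψ t z) θ₀ := fun z =>
    (hderivc z).div (hd z).continuousAt (hpos z).ne'
  have hGc : ContinuousAt G θ₀ := by
    refine tendsto_finsetSum _ fun z _ => ?_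
    exact (continuousAt_dslope_same.2 (hd z)).mul (hψc z)
  have hGF : G θ₀ = F := by
    simp only [hG, hψ, hFdef, fisherInfo, dslope_same]
    exact Finset.sum_congr rfl fun z _ => by ring
  have hquot : ∀ z, ∀ᶠ t in 𝓝 θ₀, |ψ t z / G t - ψ θ₀ z / F| < ε := by
    intro z
    have h : ContinuousAt (fun t => |ψ t z / G t - ψ θ₀ z / F|) θ₀ :=
      (((hψc z).div hGc (by rw [hGF]; exact hF.ne')).sub continuousAt_const).abs
    refine h.eventually_lt_const ?_
    simpa [hGF] using hε
  have hev : ∀ᶠ t in 𝓝 θ₀, t ∈ interior K ∧ G t ≠ 0 ∧ (∀ x, 0 < p x t) ∧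
      (∀ x, DifferentiableAt ℝ (p x) t) ∧ ∀ z, |ψ t z / G t - ψ θ₀ z / F| < ε := by
    have hint : ∀ᶠ t in 𝓝 θ₀, t ∈ interior K := isOpen_interior.mem_nhds hθ
    refine hint.and
      ((hGc.eventually_ne (by rw [hGF]; exact hF.ne')).and
      ((eventually_all.2 fun x => (hd x).continuousAt.eventually_const_lt (hpos x)).and
      ((eventually_all.2 fun x => ?_).and (eventually_all.2 hquot))))
    exact ((hC1 x).eventually (by simp)).mono fun t ht => ht.differentiableAt one_ne_zero
  obtain ⟨δ, hδ, hball⟩ := Metric.eventually_nhds_iff_ball.1 hev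
  have hθK : θ₀ ∈ K := interior_subset hθ
  -- The complement of the ball in `K` is compact, so for a nearly exact empirical distribution the
  -- maximizer lies in the ball. There it is interior to `K` and satisfies the likelihood equation.
  obtain ⟨η, hη, hlt⟩ := exists_likelihood_lt (hK.diff Metric.isOpen_ball (t := Metric.ball θ₀ δ))
    (fun x => (hcont x).mono Set.sdiff_subset) (fun t ht => hnn t ht.1) (fun t ht => hsum t ht.1)
    hpos (hsum θ₀ hθK) (fun t ht => hne t ht.1 fun h =>
      ht.2 (h ▸ Metric.mem_ball_self hδ))
  refine ⟨η, hη, fun m hm x hx => ?_⟩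
  set t := est m x with ht
  obtain ⟨htK, htmax⟩ := hest m x
  have htball : t ∈ Metric.ball θ₀ δ := by
    by_contra h
    exact absurd (htmax θ₀ hθK) (not_le.2 (hlt m hm x hx t ⟨htK, h⟩))
  obtain ⟨hint, hGt, hpt, hdt, hψt⟩ := hball t htball
  have hm0 : (m : ℝ) ≠ 0 := by exact_mod_cast hm.ne'
  have hKnhds : K ∈ 𝓝 t := mem_interior_iff_mem_nhds.1 hint
  have hlocmax : IsLocalMax (jointProb p m x) t := by
    filter_upwards [hKnhds] with s hs using htmax s hs
  have hzero := hlocmax.hasDerivAt_eq_zero (hasDerivAt_jointProb hpt hdt m x)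
  rw [mul_eq_zero, or_iff_right (Finset.prod_pos fun r _ => hpt (x r)).ne'] at hzero
  have hz1 := sum_eq_empDev (fun a => p a θ₀) hm x (ψ t)
  rw [show ∑ r, ψ t (x r) = 0 from hzero, eq_comm, mul_eq_zero, or_iff_right hm0] at hz1
  have hz2 : ∑ z, p z t * ψ t z = 0 := by
    refine sum_mul_deriv_div hpt (sum_deriv_eq_zero ?_ hdt)
    filter_upwards [hKnhds] with s hs using hsum s hs
  set d := empDev (fun a => p a θ₀) m x with hdd
  -- Subtract two relations for the score `ψ t`: its empirical mean is zero by the likelihood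
  -- equation, and its mean under `p(·|t)` is zero by normalization.
  have hmain : (t - θ₀) * G t = ∑ z, d z * ψ t z := by
    have h1 : ∀ z, (t - θ₀) * (dslope (p z) θ₀ t * ψ t z) = (p z t - p z θ₀) * ψ t z := by
      intro z
      rw [← sub_smul_dslope (p z) θ₀ t, smul_eq_mul, mul_assoc]
    rw [hG]
    simp only [Finset.mul_sum, h1, sub_mul, Finset.sum_sub_distrib, hz2]
    simp only [add_mul, Finset.sum_add_distrib] at hz1
    linarith
  have hrep : t - θ₀ - (∑ z, d z * ψ θ₀ z) / F = ∑ z, d z * (ψ t z / G t - ψ θ₀ z / F) := by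
    have h1 : t - θ₀ = (∑ z, d z * ψ t z) / G t := by rw [← hmain, mul_div_cancel_right₀ _ hGt]
    rw [h1, Finset.sum_div, Finset.sum_div, ← Finset.sum_sub_distrib]
    exact Finset.sum_congr rfl fun z _ => by ring
  rw [show (∑ z, d z * (deriv (p z) θ₀ / p z θ₀)) = ∑ z, d z * ψ θ₀ z from rfl, hrep,
    Finset.mul_sum]
  refine (Finset.abs_sum_le_sum_abs _ _).trans (Finset.sum_le_sum fun z _ => ?_)
  rw [abs_mul, mul_comm]
  exact mul_le_mul_of_nonneg_right (hψt z).le (abs_nonneg _)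

/-- The maximum-likelihood estimator over a compact set has asymptotic variance `1 / (m F)`, and
its covariance with the score tends to one. -/
theorem tendsto_mle_variance {K : Set ℝ} (hK : IsCompact K) (hnn : ∀ t ∈ K, ∀ x, 0 ≤ p x t)
    (hsum : ∀ t ∈ K, ∑ x, p x t = 1) (hcont : ∀ x, ContinuousOn (p x) K) {θ₀ : ℝ}
    (hθ : θ₀ ∈ interior K) (hpos : ∀ x, 0 < p x θ₀) (hC1 : ∀ x, ContDiffAt ℝ 1 (p x) θ₀)
    (hne : ∀ t ∈ K, t ≠ θ₀ → ∃ x, p x t ≠ p x θ₀) (hF : 0 < fisherInfo p θ₀)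
    {est : EstimatorSeq X} (hest : IsMLE p K est) :
    Tendsto (fun m : ℕ => (m : ℝ) * iidSum (fun a => p a θ₀) m (fun x =>
      (est m x - iidSum (fun a => p a θ₀) m (est m)) ^ 2)) atTop (𝓝 (1 / fisherInfo p θ₀)) ∧
    Tendsto (fun m : ℕ => iidSum (fun a => p a θ₀) m (fun x =>
      (∑ r, deriv (p (x r)) θ₀ / p (x r) θ₀) * est m x)) atTop (𝓝 1) := by
  set F := fisherInfo p θ₀ with hFdef
  set P : X → ℝ := fun a => p a θ₀ with hPdef
  set ψ : X → ℝ := fun z => deriv (p z) θ₀ / p z θ₀ with hψ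
  have hθK : θ₀ ∈ K := interior_subset hθ
  have hP0 : ∀ x, 0 ≤ P x := fun x => (hpos x).le
  have hP1 : ∑ x, P x = 1 := hsum θ₀ hθK
  have hψ0 : ∑ z, P z * ψ z = 0 := by
    refine sum_mul_deriv_div hpos (sum_deriv_eq_zero ?_
      fun x => (hC1 x).differentiableAt one_ne_zero)
    filter_upwards [mem_interior_iff_mem_nhds.1 hθ] with s hs using hsum s hs
  have hψ2 : ∑ z, P z * ψ z ^ 2 = F := by
    rw [hFdef, fisherInfo]
    refine Finset.sum_congr rfl fun z _ => ?_
    have := (hpos z).ne'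
    simp only [hPdef, hψ]
    field_simp
  -- Linear part of the estimation error, centred with `m E Z² = 1 / F`. Everything reduces to
  -- showing that the remainder `e` satisfies `m E e² → 0`.
  set Z : (m : ℕ) → (Fin m → X) → ℝ := fun m x => ((m : ℝ) * F)⁻¹ * ∑ r, ψ (x r) with hZ
  have hZd : ∀ m > 0, ∀ x : Fin m → X, Z m x = (∑ z, empDev P m x z * ψ z) / F := by
    intro m hm x
    have hm0 : (m : ℝ) ≠ 0 := by exact_mod_cast hm.ne'
    simp only [hZ]
    rw [sum_eq_empDev P hm x ψ]
    simp only [add_mul, Finset.sum_add_distrib, hψ0, zero_add]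
    field_simp
  set e : (m : ℕ) → (Fin m → X) → ℝ := fun m x => est m x - θ₀ - Z m x with he
  obtain ⟨B, hB⟩ := hK.isBounded.exists_norm_le
  have hZb : ∀ m x, |Z m x| ≤ (∑ z, |ψ z|) / F := by
    intro m x
    rcases Nat.eq_zero_or_pos m with rfl | hm
    · simp only [hZ, Finset.univ_eq_empty, Finset.sum_empty, mul_zero, abs_zero]
      positivity
    · rw [hZd m hm, abs_div, abs_of_pos hF]
      refine div_le_div_of_nonneg_right ((Finset.abs_sum_le_sum_abs _ _).trans
        (Finset.sum_le_sum fun z _ => ?_)) hF.le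
      rw [abs_mul]
      exact mul_le_of_le_one_left (abs_nonneg _) (abs_empDev_le hP0 hP1 m x z)
  have heb : ∀ m x, |e m x| ≤ B + B + (∑ z, |ψ z|) / F := by
    intro m x
    simp only [he]
    have h1 := hB _ (hest m x).1
    have h2 := hB _ hθK
    rw [Real.norm_eq_abs] at h1 h2
    refine (abs_sub _ _).trans (add_le_add ((abs_sub _ _).trans (add_le_add h1 h2)) (hZb m x))
  have hlim : Tendsto (fun m : ℕ => (m : ℝ) * iidSum P m (fun x => e m x ^ 2)) atTop (𝓝 0) := by
    refine tendsto_mul_iidSum_sq hP0 hP1 e heb fun ε hε => ?_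
    set c : ℝ := (Fintype.card X : ℝ) with hc
    have hc0 : 0 ≤ c := Nat.cast_nonneg _
    obtain ⟨η, hη, h⟩ := exists_mle_expansion hK hnn hsum hcont hθ hpos hC1 hne hF hest
      (ε := √(ε / (c + 1))) (Real.sqrt_pos.2 (by positivity))
    refine ⟨η, hη, fun m hm x hx => ?_⟩
    have h1 := h m hm x hx
    have h2 : |e m x| ≤ √(ε / (c + 1)) * ∑ z, |empDev P m x z| := by
      simp only [he, hZd m hm]
      exact h1
    have h3 := pow_le_pow_left₀ (abs_nonneg _) h2 2
    rw [sq_abs, mul_pow, Real.sq_sqrt (by positivity)] at h3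
    have h4 : (∑ z, |empDev P m x z|) ^ 2 ≤ c * ∑ z, empDev P m x z ^ 2 := by
      have := sq_sum_le_card_mul_sum_sq (s := Finset.univ) (f := fun z => |empDev P m x z|)
      simpa [hc, sq_abs] using this
    have h5 : 0 ≤ ∑ z, empDev P m x z ^ 2 := by positivity
    calc _ ≤ _ := h3
      _ ≤ ε / (c + 1) * (c * ∑ z, empDev P m x z ^ 2) := by gcongr
      _ = ε * (c / (c + 1)) * ∑ z, empDev P m x z ^ 2 := by ring
      _ ≤ ε * ∑ z, empDev P m x z ^ 2 := by
          refine mul_le_mul_of_nonneg_right (mul_le_of_le_one_right hε.le ?_) h5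
          exact div_le_one_of_le₀ (by linarith) (by linarith)
  have hZ1 : ∀ m, iidSum P m (Z m) = 0 := by
    intro m
    simp only [hZ]
    rw [iidSum_const_mul, iidSum_sum, hψ0]; simp
  have hZ2 : ∀ m : ℕ, 0 < m → (m : ℝ) * iidSum P m (fun x => Z m x ^ 2) = 1 / F := by
    intro m hm
    have hm0 : (m : ℝ) ≠ 0 := by exact_mod_cast hm.ne'
    simp only [hZ, mul_pow]
    rw [iidSum_const_mul, iidSum_sq_of_centered hP1 hψ0, hψ2]
    field_simp
  -- Cauchy–Schwarz: `(m E Ze)² ≤ (m E Z²)(m E e²)`, where the first factor is `1 / F`.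
  have hcross : Tendsto (fun m : ℕ => (m : ℝ) * iidSum P m (fun x => Z m x * e m x))
      atTop (𝓝 0) := by
    have hb : Tendsto (fun m : ℕ => √(1 / F * (m * iidSum P m (fun x => e m x ^ 2))))
        atTop (𝓝 0) := by
      have := (Real.continuous_sqrt.tendsto _).comp (hlim.const_mul (1 / F))
      simpa [Function.comp_def] using this
    refine squeeze_zero_norm' ?_ hb
    filter_upwards [eventually_gt_atTop 0] with m hm
    rw [Real.norm_eq_abs]
    refine Real.abs_le_sqrt ?_
    rw [← hZ2 m hm]
    have := mul_le_mul_of_nonneg_left (sq_iidSum_mul_le hP0 (Z m) (e m)) (sq_nonneg (m : ℝ))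
    nlinarith
  have hest_eq : ∀ m x, est m x = θ₀ + Z m x + e m x := fun m x => by simp only [he]; ring
  constructor
  · have hmean : Tendsto (fun m : ℕ => (m : ℝ) * iidSum P m (e m) ^ 2) atTop (𝓝 0) :=
      squeeze_zero (fun m => by positivity)
        (fun m => mul_le_mul_of_nonneg_left (sq_iidSum_le hP0 hP1 (e m)) m.cast_nonneg) hlim
    have h := (((tendsto_const_nhds (x := 1 / F)).add (hcross.const_mul 2)).add hlim).sub hmean
    simp only [mul_zero, add_zero, sub_zero] at h
    refine Tendsto.congr' ?_ h
    filter_upwards [eventually_gt_atTop 0] with m hm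
    have hv := iidSum_variance hP1 (hZ1 m) θ₀ (e m)
    simp only [← hest_eq] at hv
    rw [show (iidSum P m (est m)) = iidSum P m (fun x => est m x) from rfl, hv, ← hZ2 m hm]
    ring
  · have h := (hcross.const_mul F).const_add 1
    rw [mul_zero, add_zero] at h
    refine Tendsto.congr' ?_ h
    filter_upwards [eventually_gt_atTop 0] with m hm
    have hm0 : (m : ℝ) ≠ 0 := by exact_mod_cast hm.ne'
    -- The total score is `m F Z`, so its pairing with the estimator is `F (m E Z²) + F (m E Ze)`,
    -- and the first term is one.
    have h1 : ∀ x : Fin m → X, (∑ r, ψ (x r)) * est m x =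
        m * F * θ₀ * Z m x + m * F * Z m x ^ 2 + m * F * (Z m x * e m x) := by
      intro x
      have : ∑ r, ψ (x r) = m * F * Z m x := by
        simp only [hZ]; field_simp
      rw [this, hest_eq]; ring
    have h2 := hZ2 m hm
    have h3 : iidSum P m (fun x => (∑ r, ψ (x r)) * est m x) =
        F * (m * iidSum P m (fun x => Z m x ^ 2)) +
          F * (m * iidSum P m (fun x => Z m x * e m x)) := by
      simp only [h1, iidSum_add, iidSum_const_mul]
      rw [show (iidSum P m fun x => Z m x) = 0 from hZ1 m]
      ring
    refine Eq.trans ?_ h3.symm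
    rw [h2, mul_one_div_cancel hF.ne']

/-- The maximum-likelihood estimator over a finite set has variance `o(1 / m)`. -/
theorem tendsto_finite_mle_variance {S : Set ℝ} (hS : S.Finite) (hnn : ∀ t ∈ S, ∀ x, 0 ≤ p x t)
    (hsum : ∀ t ∈ S, ∑ x, p x t = 1) {θ₀ : ℝ} (hθ : θ₀ ∈ S) (hpos : ∀ x, 0 < p x θ₀)
    (hne : ∀ t ∈ S, t ≠ θ₀ → ∃ x, p x t ≠ p x θ₀)
    {est : EstimatorSeq X} (hest : IsMLE p S est) :
    Tendsto (fun m : ℕ => (m : ℝ) * iidSum (fun a => p a θ₀) m (fun x =>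
      (est m x - iidSum (fun a => p a θ₀) m (est m)) ^ 2)) atTop (𝓝 0) := by
  set P : X → ℝ := fun a => p a θ₀ with hPdef
  have hP0 : ∀ x, 0 ≤ P x := fun x => (hpos x).le
  have hP1 : ∑ x, P x = 1 := hsum θ₀ hθ
  obtain ⟨B, hB⟩ := hS.isCompact.isBounded.exists_norm_le
  have hS' : (S \ {θ₀}).Finite := hS.sdiff
  obtain ⟨η, hη, hlt⟩ := exists_likelihood_lt hS'.isCompact (fun x => hS'.continuousOn (p x))
    (fun t ht => hnn t ht.1) (fun t ht => hsum t ht.1) hpos hP1 (fun t ht => hne t ht.1 ht.2)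
  have hlim : Tendsto (fun m : ℕ => (m : ℝ) * iidSum P m (fun x => (est m x - θ₀) ^ 2))
      atTop (𝓝 0) := by
    refine tendsto_mul_iidSum_sq hP0 hP1 (fun m x => est m x - θ₀) (D := B + B) ?_ ?_
    · intro m x
      exact (abs_sub _ _).trans (add_le_add (hB _ (hest m x).1) (hB _ hθ))
    · intro ε hε
      refine ⟨η, hη, fun m hm x hx => ?_⟩
      -- In a finite set, being close to the truth means being equal to it, so the error vanishes
      -- for small deviations.
      have h0 : est m x = θ₀ := by
        by_contra h
        exact absurd ((hest m x).2 θ₀ hθ) (not_le.2 (hlt m hm x hx _ ⟨(hest m x).1, h⟩))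
      rw [h0, sub_self]
      have : 0 ≤ ∑ z, empDev P m x z ^ 2 := by positivity
      simpa using mul_nonneg hε.le this
  refine squeeze_zero (fun m => mul_nonneg m.cast_nonneg (Finset.sum_nonneg fun x _ =>
    mul_nonneg (Finset.prod_nonneg fun r _ => hP0 _) (sq_nonneg _)))
    (fun m => mul_le_mul_of_nonneg_left ?_ m.cast_nonneg) hlim
  -- With main part zero this says that the variance is at most the second moment about `θ₀`.
  have hv := iidSum_variance hP1 (m := m) (Z := fun _ => 0) (by simp [iidSum_const]) θ₀
    (fun x => est m x - θ₀)
  simp only [add_zero, add_sub_cancel] at hv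
  rw [show (iidSum P m (est m)) = iidSum P m (fun x => est m x) from rfl, hv]
  have h0 : iidSum P m (fun _ => (0 : ℝ)) = 0 := by simp [iidSum_const]
  simp only [ne_eq, OfNat.ofNat_ne_zero, not_false_eq_true, zero_pow, zero_mul, h0]
  nlinarith [sq_nonneg (iidSum P m fun x => est m x - θ₀)]

end MLE

/-! ### Saturation of the bounds -/

section Saturation

variable {X : Type*} [Fintype X] {n : ℕ} {p : X → ℝ → ℝ} {θ : Fin n → ℝ} {w : Fin n → ℝ}

theorem gcrRep_le_fgRep (hpos : ∀ i x, 0 < p x (θ i)) (hw : ∀ i, 0 ≤ w i) (est : EstimatorSeq X)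
    (m : ℕ) : gcrRep w p θ est m ≤ fgRep w p θ est m :=
  globalCRBound_le_fullyGlobalBound _ _ hw (dist_m_pos hpos m)

theorem fgRep_le_varRep (hpos : ∀ i x, 0 < p x (θ i)) (hw : ∀ i, 0 ≤ w i) (est : EstimatorSeq X)
    (m : ℕ) : fgRep w p θ est m ≤ varRep w p θ est m :=
  fullyGlobalBound_le_weightedVar _ _ hw (dist_m_pos hpos m)

theorem varRep_eq (est : EstimatorSeq X) (m : ℕ) :
    varRep w p θ est m = ∑ i, w i * iidSum (fun a => p a (θ i)) m (fun x =>
      (est m x - iidSum (fun a => p a (θ i)) m (est m)) ^ 2) := rfl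

theorem tendsto_mul_varRep {v : Fin n → ℝ} {est : EstimatorSeq X}
    (h : ∀ i, Tendsto (fun m : ℕ => (m : ℝ) * iidSum (fun a => p a (θ i)) m (fun x =>
      (est m x - iidSum (fun a => p a (θ i)) m (est m)) ^ 2)) atTop (𝓝 (v i))) :
    Tendsto (fun m : ℕ => (m : ℝ) * varRep w p θ est m) atTop (𝓝 (∑ i, w i * v i)) := by
  refine (tendsto_finsetSum Finset.univ fun i _ => (h i).const_mul (w i)).congr fun m => ?_
  rw [varRep_eq, Finset.mul_sum]
  exact Finset.sum_congr rfl fun i _ => by ring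

theorem isEquivalent_of_tendsto_mul {u v : ℕ → ℝ} {L : ℝ} (hL : L ≠ 0)
    (hu : Tendsto (fun m : ℕ => (m : ℝ) * u m) atTop (𝓝 L))
    (hv : Tendsto (fun m : ℕ => (m : ℝ) * v m) atTop (𝓝 L)) : u ~[atTop] v := by
  have h := ((isEquivalent_const_iff_tendsto hL).2 hu).trans
    ((isEquivalent_const_iff_tendsto hL).2 hv).symm
  have h2 := (IsEquivalent.refl (u := fun m : ℕ => (m : ℝ)⁻¹) (l := atTop)).mul h
  have hcancel : ∀ u : ℕ → ℝ, (fun m : ℕ => (m : ℝ)⁻¹) * (fun m : ℕ => (m : ℝ) * u m)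
      =ᶠ[atTop] u := by
    intro u
    filter_upwards [eventually_gt_atTop 0] with m hm
    have hm0 : (m : ℝ) ≠ 0 := by exact_mod_cast hm.ne'
    simp [hm0]
  exact (h2.congr_left (hcancel u)).congr_right (hcancel v)

/-- Since `b_i → 1`, `m` times the global Cramér–Rao bound has the same limit as `m` times the
variance, and the fully global bound is squeezed between. The limit is positive because some weight
is, and this makes equal limits an asymptotic equivalence. -/
theorem mle_saturation {K : Set ℝ} (hnonneg : ∀ t ∈ K, ∀ x, 0 ≤ p x t)
    (hsum : ∀ t ∈ K, ∑ x, p x t = 1) (hθ : ∀ i, θ i ∈ interior K)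
    (hpos : ∀ i x, 0 < p x (θ i)) (hdiff : ∀ i x, DifferentiableAt ℝ (p x) (θ i))
    (hderiv : ∀ i, ∑ x, deriv (p x) (θ i) = 0) (hw : ∀ i, 0 ≤ w i) (hw1 : ∑ i, w i = 1)
    (hK : IsCompact K) (hcont : ∀ x, ContinuousOn (p x) K)
    (hC1 : ∀ i x, ContDiffAt ℝ 1 (p x) (θ i))
    (hne : ∀ i, ∀ t ∈ K, t ≠ θ i → ∃ x, p x t ≠ p x (θ i))
    (hF : ∀ i, 0 < fisherInfo p (θ i)) {est : EstimatorSeq X} (hest : IsMLE p K est) :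
    varRep w p θ est ~[atTop] gcrRep w p θ est ∧ varRep w p θ est ~[atTop] fgRep w p θ est ∧
      Tendsto (fun m : ℕ => (m : ℝ) * varRep w p θ est m) atTop
        (𝓝 (∑ i, w i / fisherInfo p (θ i))) := by
  have hsumθ : ∀ i, ∑ x, p x (θ i) = 1 := fun i => hsum _ (interior_subset (hθ i))
  have hmle := fun i => tendsto_mle_variance hK hnonneg hsum hcont (hθ i) (hpos i) (hC1 i)
    (hne i) (hF i) hest
  set L := ∑ i, w i / fisherInfo p (θ i) with hLdef
  have hL : 0 < L := by
    obtain ⟨i, hi⟩ : ∃ i, 0 < w i := by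
      by_contra! h
      have : ∑ i, w i ≤ 0 := Finset.sum_nonpos fun i _ => h i
      linarith
    exact Finset.sum_pos' (fun i _ => div_nonneg (hw i) (hF i).le)
      ⟨i, Finset.mem_univ _, div_pos hi (hF i)⟩
  have hvar : Tendsto (fun m : ℕ => (m : ℝ) * varRep w p θ est m) atTop (𝓝 L) := by
    have := tendsto_mul_varRep (w := w) fun i => (hmle i).1
    simpa only [mul_one_div] using this
  have hbias : ∀ i, Tendsto (biasRep p θ est i i) atTop (𝓝 1) := by
    intro i
    refine (hmle i).2.congr fun m => ?_
    rw [biasRep_eq hpos hdiff hderiv, iidSum]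
    refine Finset.sum_congr rfl fun x _ => ?_
    rw [score_m_eq hpos hdiff]
    ring
  have hgcr : Tendsto (fun m : ℕ => (m : ℝ) * gcrRep w p θ est m) atTop (𝓝 L) := by
    have h := tendsto_finsetSum Finset.univ fun i _ =>
      (((hbias i).pow 2).div_const (fisherInfo p (θ i))).const_mul (w i)
    simp only [one_pow, mul_one_div] at h
    refine Tendsto.congr' ?_ h
    filter_upwards [eventually_gt_atTop 0] with m hm
    have hm0 : (m : ℝ) ≠ 0 := by exact_mod_cast hm.ne'
    rw [gcrRep_eq hpos hdiff hsumθ hderiv, Finset.mul_sum]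
    refine Finset.sum_congr rfl fun i _ => ?_
    have := (hF i).ne'
    field_simp
  have hfg : Tendsto (fun m : ℕ => (m : ℝ) * fgRep w p θ est m) atTop (𝓝 L) :=
    tendsto_of_tendsto_of_tendsto_of_le_of_le hgcr hvar
      (fun m => mul_le_mul_of_nonneg_left (gcrRep_le_fgRep hpos hw est m) m.cast_nonneg)
      (fun m => mul_le_mul_of_nonneg_left (fgRep_le_varRep hpos hw est m) m.cast_nonneg)
  exact ⟨isEquivalent_of_tendsto_mul hL.ne' hvar hgcr, isEquivalent_of_tendsto_mul hL.ne' hvar hfg,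
    hvar⟩

/-- Both bounds lie between zero and the variance, so it suffices that `m` times the variance tends
to zero. -/
theorem finite_mle_saturation (hpos : ∀ i x, 0 < p x (θ i)) (hsum : ∀ i, ∑ x, p x (θ i) = 1)
    (hw : ∀ i, 0 ≤ w i) (hne : ∀ i j, (∀ x, p x (θ j) = p x (θ i)) → θ j = θ i)
    {est : EstimatorSeq X} (hest : IsMLE p (Set.range θ) est) :
    Tendsto (fun m : ℕ => (m : ℝ) * (varRep w p θ est m - gcrRep w p θ est m)) atTop (𝓝 0) ∧
      Tendsto (fun m : ℕ => (m : ℝ) * (varRep w p θ est m - fgRep w p θ est m)) atTop (𝓝 0) := by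
  have hvar : Tendsto (fun m : ℕ => (m : ℝ) * varRep w p θ est m) atTop (𝓝 0) := by
    have := tendsto_mul_varRep (w := w) (p := p) (θ := θ) (v := fun _ => 0) (est := est) fun i =>
      tendsto_finite_mle_variance (Set.finite_range θ)
        (by rintro _ ⟨j, rfl⟩ x; exact (hpos j x).le) (by rintro _ ⟨j, rfl⟩; exact hsum j)
        (Set.mem_range_self i) (hpos i)
        (by
          rintro _ ⟨j, rfl⟩ hji
          by_contra! h
          exact hji (hne i j h)) hest
    simpa using this
  have h0 : ∀ m, 0 ≤ gcrRep w p θ est m := fun m =>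
    globalCRBound_nonneg _ _ hw (dist_m_pos hpos m)
  have h1 := gcrRep_le_fgRep (w := w) hpos hw est
  have h2 := fgRep_le_varRep (w := w) hpos hw est
  constructor
  · exact squeeze_zero
      (fun m => mul_nonneg m.cast_nonneg (by linarith [h1 m, h2 m]))
      (fun m => mul_le_mul_of_nonneg_left (by linarith [h0 m]) m.cast_nonneg) hvar
  · exact squeeze_zero
      (fun m => mul_nonneg m.cast_nonneg (by linarith [h2 m]))
      (fun m => mul_le_mul_of_nonneg_left (by linarith [h0 m, h1 m]) m.cast_nonneg) hvar

end Saturation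

theorem mainTheorem4 {X : Type*} [Fintype X] {n : ℕ}
    -- the model `p x t = p(x|t)` on a parameter domain `K`, and the values `θ i`
    (p : X → ℝ → ℝ) (K : Set ℝ)
    (hnonneg : ∀ t ∈ K, ∀ x, 0 ≤ p x t) (hsum : ∀ t ∈ K, ∑ x, p x t = 1)
    (θ : Fin n → ℝ) (hθ : ∀ i, θ i ∈ interior K)
    (hpos : ∀ i x, 0 < p x (θ i)) (hdiff : ∀ i x, DifferentiableAt ℝ (p x) (θ i))
    (w : Fin n → ℝ) (hw : ∀ i, 0 ≤ w i) (hw1 : ∑ i, w i = 1) :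
    -- the two bounds are the optimal values over all, resp. all diagonal, hierarchy matrices,
    -- and they bound the weighted variance
    (∀ (est : EstimatorSeq X) (m : ℕ),
      IsLUB (Set.range fun A : Matrix (Fin n) (Fin n) ℝ =>
        scoreBound w (dist_m p θ m) (score_m p θ m) (est m) A) (fgRep w p θ est m) ∧
      IsLUB (Set.range fun a : Fin n → ℝ =>
        scoreBound w (dist_m p θ m) (score_m p θ m) (est m) (Matrix.diagonal a))
        (gcrRep w p θ est m) ∧
      gcrRep w p θ est m ≤ fgRep w p θ est m ∧ fgRep w p θ est m ≤ varRep w p θ est m) ∧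
    -- the chi-square overlap of two distributions
    (∀ P Q : X → ℝ, (∀ x, 0 ≤ P x) → (∀ x, 0 ≤ Q x) → ∑ x, P x = 1 → ∑ x, Q x = 1 →
      (∀ x, 0 < Q x → 0 < P x) →
      1 ≤ ∑ x, Q x ^ 2 / P x ∧ (∑ x, Q x ^ 2 / P x = 1 ↔ Q = P)) ∧
    -- the limiting form of a block pseudoinverse
    (∀ (k : ℕ) (D : ℕ → Matrix (Fin k) (Fin k) ℝ) (v : ℕ → Fin k → ℝ) (c : ℕ → ℝ),
      (∀ m, (D m).IsSymm) → (∀ m, ∃ u, D m *ᵥ u = v m) →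
      Tendsto (fun m => pinv (D m)) atTop (𝓝 0) →
      (∃ B, ∀ m j, |v m j| ≤ B) → (∃ ε > 0, ∀ m, ε ≤ |c m|) →
      Tendsto (fun m =>
        pinv (Matrix.fromBlocks (D m) (Matrix.replicateCol Unit (v m))
          (Matrix.replicateRow Unit (v m)) (Matrix.of fun _ _ => c m)) -
        Matrix.fromBlocks 0 0 0 (Matrix.of fun _ _ => 1 / c m)) atTop (𝓝 0)) ∧
    -- the exact formula for the information matrix of `m` repetitions
    (∀ (m : ℕ) (i j k : Fin n), infoRep p θ i m j k =
      (m : ℝ) * ((m : ℝ) - 1) * lam p θ i j k ^ (m - 2) * (rCoef p θ i j k * rCoef p θ i k j) +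
        (m : ℝ) * lam p θ i j k ^ (m - 1) * infoRep p θ i 1 j k) ∧
    (∀ i j k : Fin n,
      infoRep p θ i 1 j k = ∑ x, deriv (p x) (θ j) * deriv (p x) (θ k) / p x (θ i)) ∧
    -- the limit of the pseudoinverse of the normalized information matrix
    (∀ i : Fin n, (∀ j, j ≠ i → ∃ x, p x (θ j) ≠ p x (θ i)) →
      Tendsto (fun m : ℕ => pinv ((m : ℝ)⁻¹ • infoRep p θ i m)) atTop
        (𝓝 (Matrix.single i i (1 / infoRep p θ i 1 i i)))) ∧
    -- asymptotic equality of the two bounds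
    ((∀ i j, (∀ x, p x (θ j) = p x (θ i)) →
        ∃ r : ℝ, ∀ x, deriv (p x) (θ j) = r * deriv (p x) (θ i)) →
      ∀ est : EstimatorSeq X,
        ((∀ j, w j = 0 → (fun m => biasRep p θ est j j m ^ 2) =O[atTop]
            fun m => ∑ i, w i * biasRep p θ est i i m ^ 2) →
          fgRep w p θ est ~[atTop] gcrRep w p θ est) ∧
        ((∀ j, biasRep p θ est j j =O[atTop] fun _ => (1 : ℝ)) →
          Tendsto (fun m : ℕ => (m : ℝ) * (fgRep w p θ est m - gcrRep w p θ est m))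
            atTop (𝓝 0))) ∧
    -- saturation by the maximum-likelihood estimator over a compact parameter domain
    (IsCompact K → (∀ x, ContinuousOn (p x) K) → (∀ i x, ContDiffAt ℝ 1 (p x) (θ i)) →
      (∀ i, ∀ t ∈ K, t ≠ θ i → ∃ x, p x t ≠ p x (θ i)) → (∀ i, 0 < fisherInfo p (θ i)) →
      ∀ est : EstimatorSeq X, IsMLE p K est →
        varRep w p θ est ~[atTop] gcrRep w p θ est ∧
        varRep w p θ est ~[atTop] fgRep w p θ est ∧
        Tendsto (fun m : ℕ => (m : ℝ) * varRep w p θ est m) atTop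
          (𝓝 (∑ i, w i / fisherInfo p (θ i)))) ∧
    -- saturation, on the scale `1 / m`, by the maximum-likelihood estimator over the finite set
    ((∀ i j, (∀ x, p x (θ j) = p x (θ i)) → θ j = θ i) →
      ∀ est : EstimatorSeq X, IsMLE p (Set.range θ) est →
        Tendsto (fun m : ℕ => (m : ℝ) * (varRep w p θ est m - gcrRep w p θ est m))
          atTop (𝓝 0) ∧
        Tendsto (fun m : ℕ => (m : ℝ) * (varRep w p θ est m - fgRep w p θ est m))
          atTop (𝓝 0)) := by
  have hsumθ : ∀ i, ∑ x, p x (θ i) = 1 := fun i => hsum _ (interior_subset (hθ i))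
  have hderiv : ∀ i, ∑ x, deriv (p x) (θ i) = 0 := fun i => by
    refine sum_deriv_eq_zero ?_ (hdiff i)
    filter_upwards [mem_interior_iff_mem_nhds.1 (hθ i)] with s hs using hsum s hs
  refine ⟨fun est m => ⟨isLUB_fullyGlobalBound _ _ hw (dist_m_pos hpos m),
      isLUB_globalCRBound _ _ hw (dist_m_pos hpos m), gcrRep_le_fgRep hpos hw est m,
      fgRep_le_varRep hpos hw est m⟩,
    chiSq_overlap, tendsto_pinv_fromBlocks, infoRep_eq hpos hdiff, infoRep_one hpos hdiff,
    fun i hi => tendsto_pinv_infoRep hpos hdiff hsumθ hderiv i hi,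
    fun hown est => ⟨fgRep_isEquivalent_gcrRep hpos hdiff hsumθ hderiv hw hown est,
      tendsto_fgRep_sub_gcrRep hpos hdiff hsumθ hderiv hw hown est⟩,
    fun hK hcont hC1 hne hF est hest => mle_saturation hnonneg hsum hθ hpos hdiff hderiv hw hw1 hK
      hcont hC1 hne hF hest,
    fun hne est hest => finite_mle_saturation hpos hsumθ hw hne hest⟩
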